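/- All graphs are simple. For graphs $X,Y$ on $n$ vertices, the friends-and-strangers graph $\mathsf{FS}(X,Y)$ has as vertices the bijections $\sigma:V(X)\to V(Y)$; two bijections $\sigma,\sigma'$ are adjacent if and only if there is an edge $\{a,b\}\in E(X)$ such that $\{\sigma(a),\sigma(b)\}\in E(Y)$, $\sigma(a)=\sigma'(b)$, $\sigma(b)=\sigma'(a)$, and $\sigma(c)=\sigma'(c)$ for all $c\in V(X)\setminus\{a,b\}$. Let $K_{k_1,\dots,k_t}$ denote the complete $t$-partite graph with partition classes of sizes $k_1,\dots,k_t$. For $k\ge 2$, a $k$-bridge in a graph is a path $v_1,\dots,v_k$ in it such that each edge of the path is a cut-edge, $v_2,\dots,v_{k-1}$ have degree $2$ in the graph, and $v_1$ and $v_k$ do not have degree $1$ in the graph; a $1$-bridge is a cut-vertex. **Theorem.** Suppose $t\ge 2$ and $1\le k_1\le\cdots\le k_t$, where $n=k_1+\cdots+k_t\ge 4$. Let $X$ be a graph on $n$ vertices. The following hold: 1. Suppose $t=2$ and $k_1\ge 2$. Then $\mathsf{FS}(X,K_{k_1,n-k_1})$ is connected if $X$ is connected, is non-bipartite, is not a cycle,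 and does not contain a $k_1$-bridge. 2. Suppose $t>2$ and either $k_t>2$ or $\gcd(k_1,\dots,k_t)>1$. Then $\mathsf{FS}(X,K_{k_1,\dots,k_t})$ is connected if $X$ is connected, is not a cycle, is not a tree, and does not contain an $(n-k_t)$-bridge. 3. Suppose $t>2$, $k_1=1$, and $k_t=2$. Then $\mathsf{FS}(X,K_{k_1,\dots,k_t})$ is connected if $X$ is connected, is not a cycle, and is not a tree. -/

import Mathlib

namespace SimpleGraph

/-- The friends-and-strangers graph of `X` and `Y`: its vertices are the bijections from the
vertices of `X` to the vertices of `Y`, and its edges are the friendly swaps. -/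
def friendsStrangers {V W : Type*} (X : SimpleGraph V) (Y : SimpleGraph W) :
    SimpleGraph (V ≃ W) where
  Adj σ τ := ∃ a b : V, X.Adj a b ∧ Y.Adj (σ a) (σ b) ∧
    σ a = τ b ∧ σ b = τ a ∧ ∀ c : V, c ≠ a → c ≠ b → σ c = τ c
  symm := ⟨by
    rintro σ τ ⟨a, b, hX, hY, hab, hba, h⟩
    refine ⟨a, b, hX, ?_, hba.symm, hab.symm, fun c ha hb => (h c ha hb).symm⟩
    rw [← hab, ← hba]
    exact hY.symm⟩
  loopless := ⟨by
    rintro σ ⟨a, b, hX, -, hab, -⟩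
    exact hX.ne (σ.injective hab)⟩

/-- `X` is a cycle (through all of its at least three vertices). -/
def IsCycleGraph {V : Type*} (X : SimpleGraph V) : Prop :=
  ∃ m : ℕ, 3 ≤ m ∧ Nonempty (X ≃g cycleGraph m)

/-- `v` is a cut-vertex: deleting it disconnects two vertices that were connected before. -/
def IsCutVertex {V : Type*} (X : SimpleGraph V) (v : V) : Prop :=
  ∃ a b : ({v}ᶜ : Set V), X.Reachable a b ∧ ¬ (X.induce ({v}ᶜ : Set V)).Reachable a b

/-- `X` contains a `k`-bridge. For `k = 1` this is a cut-vertex. For `k ≥ 2` it is a path on `k`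
vertices all of whose edges are cut-edges, all of whose internal vertices have degree `2` in `X`,
and neither of whose ends has degree `1` in `X`. -/
def ContainsKBridge {V : Type*} (X : SimpleGraph V) (k : ℕ) : Prop :=
  (k = 1 ∧ ∃ v : V, X.IsCutVertex v) ∨
  (2 ≤ k ∧ ∃ (u w : V) (p : X.Walk u w), p.IsPath ∧ p.length + 1 = k ∧
    (∀ e ∈ p.edges, X.IsBridge e) ∧
    (∀ x ∈ p.support, x ≠ u → x ≠ w → (X.neighborSet x).ncard = 2) ∧
    (X.neighborSet u).ncard ≠ 1 ∧ (X.neighborSet w).ncard ≠ 1)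

end SimpleGraph

/-! Read `V` as positions of tokens; the parts of the multipartite graph become colours, and a move
swaps adjacent tokens of different colours. Inside a connected set the pattern of colours can be
rearranged at will, because exchanging two like tokens does not change it; only the labels within a
colour class are at stake. So it suffices to show that every transposition of two like tokens is
realised by moves (`reach_of_swap_mem_realized`).

Fix a colour `A`. A connected graph that is neither a tree nor a cycle has a claw. In a connected
set around the claw holding all the tokens not coloured `A` and exactly two coloured `A`, the claw
interchanges these two, possibly at the price of a transposition of two other tokens
(`isGood_of_claw`). With a third colour available the price can be undone; with two colours it is
absorbed in the subgroup `K`. Such a good set grows along ears, and by single vertices from which a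
short path leads to a branch vertex. If neither extension applies, walking inwards from an
attachment vertex traces a long path of cut-edges, which is a forbidden bridge
(`IsGood.exists_ssuperset`). Hence the whole vertex set is good; if each colour class has at most
two tokens, no growth is needed.

This settles three or more colours. For two colours the prices must be removed. A shortest odd
closed walk is a non-spanning odd cycle, and rotating it all the way round realises an odd
permutation of the `A` tokens alone (`exists_odd_of_odd_cycle`). Swappability makes the realisable
permutations of the `A` tokens a normal subgroup of their symmetric group, and a normal subgroup
with an odd element is everything. With all of these realised, the price of a transposition in the
other class can be cancelled. -/

namespace FriendsStrangers

open Equiv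

/-! ### Moves of coloured tokens and realisable relabellings. -/

section Reach

variable {V ι : Type*} [DecidableEq V]

/-- Two placements `σ`, `τ` of the tokens `V`, coloured by `c`, on the vertices of `X` differ by
swapping two tokens of different colours along an edge. -/
def Step (X : SimpleGraph V) (c : V → ι) (σ τ : Perm V) : Prop :=
  ∃ a b, X.Adj a b ∧ c (σ a) ≠ c (σ b) ∧ τ = σ * swap a b

/-- `τ` is obtained from `σ` by swaps of adjacent tokens of different colours. -/
def Reach (X : SimpleGraph V) (c : V → ι) : Perm V → Perm V → Prop :=
  Relation.ReflTransGen (Step X c)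

variable {X : SimpleGraph V} {c : V → ι} {σ τ υ : Perm V}

theorem Step.symm (h : Step X c σ τ) : Step X c τ σ := by
  obtain ⟨a, b, hab, hc, rfl⟩ := h
  exact ⟨a, b, hab, by simpa using hc.symm, by simp [mul_assoc]⟩

theorem Reach.refl (σ : Perm V) : Reach X c σ σ := Relation.ReflTransGen.refl

theorem Reach.symm (h : Reach X c σ τ) : Reach X c τ σ := by
  induction h with
  | refl => exact Reach.refl _
  | tail _ h ih => exact Relation.ReflTransGen.head h.symm ih

theorem Reach.trans (h : Reach X c σ τ) (h' : Reach X c τ υ) : Reach X c σ υ :=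
  Relation.ReflTransGen.trans h h'

theorem Reach.swap {a b : V} (hab : X.Adj a b) (hc : c (σ a) ≠ c (σ b)) :
    Reach X c σ (σ * Equiv.swap a b) :=
  Relation.ReflTransGen.single ⟨a, b, hab, hc, rfl⟩

/-- Legality of a move depends only on colours, so a colour-preserving relabelling carries move
sequences to move sequences. -/
theorem Reach.mul_left {g : Perm V} (hg : ∀ x, c (g x) = c x) (h : Reach X c σ τ) :
    Reach X c (g * σ) (g * τ) := by
  induction h with
  | refl => exact Reach.refl _
  | tail _ h ih =>
    obtain ⟨a, b, hab, hc, rfl⟩ := h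
    exact ih.tail ⟨a, b, hab, by simpa [hg] using hc, by simp [mul_assoc]⟩

/-- The colour-preserving relabellings of the tokens that can be realised by moves from `σ`. -/
def realized (X : SimpleGraph V) (c : V → ι) (σ : Perm V) : Subgroup (Perm V) where
  carrier := {g | (∀ x, c (g x) = c x) ∧ Reach X c (g * σ) σ}
  one_mem' := ⟨fun _ => rfl, by simpa using Reach.refl σ⟩
  mul_mem' := by
    rintro g h ⟨hg, hg'⟩ ⟨hh, hh'⟩
    exact ⟨fun x => by simp [hg, hh], by
      simpa [mul_assoc] using (hh'.mul_left hg).trans hg'⟩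
  inv_mem' := by
    rintro g ⟨hg, hg'⟩
    have hi : ∀ x, c (g⁻¹ x) = c x := fun x => by simpa using (hg (g⁻¹ x)).symm
    exact ⟨hi, by simpa using (hg'.mul_left hi).symm⟩

theorem mem_realized {g : Perm V} :
    g ∈ realized X c σ ↔ (∀ x, c (g x) = c x) ∧ Reach X c (g * σ) σ := Iff.rfl

/-- The group depends only on the component of the placement, so tokens may first be brought into a
convenient position. -/
theorem Reach.realized_eq (h : Reach X c σ τ) : realized X c σ = realized X c τ := by
  ext g
  simp only [mem_realized]
  refine and_congr_right fun hg => ⟨fun hs => ?_, fun ht => ?_⟩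
  · exact ((h.mul_left hg).symm.trans hs).trans h
  · exact ((h.mul_left hg).trans ht).trans h.symm

theorem color_swap_apply {p q : V} (h : c p = c q) (x : V) : c (swap p q x) = c x := by
  rw [swap_apply_def]; split_ifs <;> simp_all

/-- A relation on permutations that contains the swaps along the edges of a connected graph and is
closed under multiplication contains all permutations. -/
theorem perm_induction_of_connected {α : Type*} [DecidableEq α] [Finite α] {G : SimpleGraph α}
    (hG : G.Preconnected) {P : Perm α → Prop} (one : P 1) (mul : ∀ g h, P g → P h → P (g * h))
    (edge : ∀ a b, G.Adj a b → P (swap a b)) (g : Perm α) : P g := by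
  have key : ∀ a b, G.Reachable a b → P (swap a b) := by
    rintro a b ⟨p⟩
    induction p with
    | nil => rw [swap_self]; exact one
    | @cons u v w h p ih =>
      rcases eq_or_ne u w with rfl | huw
      · rw [swap_self]; exact one
      rcases eq_or_ne v w with rfl | hvw
      · exact edge _ _ h
      have : swap u w = swap u v * (swap v w * swap u v) := by
        rw [swap_comm u v, ← mul_assoc, swap_comm v w,
          swap_mul_swap_mul_swap hvw.symm huw.symm]
      rw [this]
      exact mul _ _ (edge _ _ h) (mul _ _ ih (edge _ _ h))
  induction g using Perm.swap_induction_on with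
  | one => exact one
  | swap_mul f x y _ ih => exact mul _ _ (key x y (hG x y)) ih

/-- If swaps of tokens of equal colour can always be realised, then all placements are reachable
from each other. -/
theorem reach_of_swap_mem_realized [Finite V] (hX : X.Preconnected)
    (h : ∀ σ p q, c p = c q → swap p q ∈ realized X c σ) (σ τ : Perm V) : Reach X c σ τ := by
  -- An edge swap of unlike tokens is a move; for like tokens `σ * swap a b` is `swap (σ a) (σ b) *
  -- σ`, a relabelling covered by `h`.
  have key : ∀ g : Perm V, ∀ σ, Reach X c σ (σ * g) := by
    refine perm_induction_of_connected hX (fun σ => by simpa using Reach.refl σ) ?_ ?_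
    · intro g k hg hk σ
      simpa [mul_assoc] using (hg σ).trans (hk (σ * g))
    · intro a b hab σ
      by_cases hc : c (σ a) = c (σ b)
      · have := (h σ _ _ hc).2.symm
        rwa [← mul_swap_eq_swap_mul] at this
      · exact Reach.swap hab hc
  simpa using key (σ⁻¹ * τ) σ

end Reach

/-! ### Rearranging colours in a connected set. -/

section Rearrange

variable {V ι : Type*} [DecidableEq V] [Finite V] {X : SimpleGraph V} {c : V → ι}

theorem exists_perm_extending {α κ : Type*} [Finite α] {f g : κ → α}
    (hf : Function.Injective f) (hg : Function.Injective g) :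
    ∃ π : Perm α, ∀ i, π (f i) = g i := by
  classical
  have := Fintype.ofFinite α
  let e : {x // x ∈ Set.range f} ≃ {x // x ∈ Set.range g} :=
    (Equiv.ofInjective f hf).symm.trans (Equiv.ofInjective g hg)
  refine ⟨e.extendSubtype, fun i => ?_⟩
  rw [e.extendSubtype_apply_of_mem _ ⟨i, rfl⟩]
  simp [e]

/-- Inside a connected set `S` the colours can be permuted arbitrarily. -/
theorem exists_reach_color_perm {S : Set V} (hS : (X.induce S).Preconnected) (g : Perm S)
    (σ : Perm V) : ∃ τ, Reach X c σ τ ∧ (∀ x : S, c (τ x) = c (σ (g x))) ∧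
      ∀ x ∉ S, τ x = σ x := by
  classical
  revert σ
  refine perm_induction_of_connected hS
    (P := fun g => ∀ σ : Perm V, ∃ τ, Reach X c σ τ ∧ (∀ x : S, c (τ x) = c (σ (g x))) ∧
      ∀ x ∉ S, τ x = σ x) (fun σ => ⟨σ, Reach.refl σ, by simp, by simp⟩) ?_ ?_ g
  · intro g h hg hh σ
    obtain ⟨τ, h1, h2, h3⟩ := hg σ
    obtain ⟨υ, h4, h5, h6⟩ := hh τ
    exact ⟨υ, h1.trans h4, fun x => by rw [h5, h2]; rfl, fun x hx => by rw [h6 x hx, h3 x hx]⟩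
  · rintro ⟨a, ha⟩ ⟨b, hb⟩ hab σ
    have hab' : X.Adj a b := hab
    have hsw : ∀ x : S, ((swap (⟨a, ha⟩ : S) ⟨b, hb⟩ x : S) : V) = swap a b (x : V) := by
      intro x
      simp only [swap_apply_def, Subtype.ext_iff]
      split_ifs <;> rfl
    by_cases hc : c (σ a) = c (σ b)
    -- Swapping equal colours leaves the pattern unchanged, so no move is needed.
    · refine ⟨σ, Reach.refl σ, fun x => ?_, fun _ _ => rfl⟩
      rw [hsw, swap_apply_def]
      split_ifs with h1 h2 <;> simp_all
    · refine ⟨_, Reach.swap hab' hc, fun x => ?_, fun x hx => ?_⟩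
      · rw [hsw]; rfl
      · rw [Perm.mul_apply, swap_apply_of_ne_of_ne] <;> rintro rfl <;> contradiction

/-- An injective partial assignment of sources to targets extends to a permutation of `S`. Only the
colours at the targets are controlled, not which tokens arrive there. -/
theorem exists_reach_color {S : Set V} (hS : (X.induce S).Preconnected) {κ : Type*} {f g : κ → V}
    (hf : Function.Injective f) (hg : Function.Injective g) (hfS : ∀ i, f i ∈ S)
    (hgS : ∀ i, g i ∈ S) (σ : Perm V) : ∃ τ, Reach X c σ τ ∧ (∀ i, c (τ (f i)) = c (σ (g i))) ∧
      ∀ x ∉ S, τ x = σ x := by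
  obtain ⟨π, hπ⟩ := exists_perm_extending (α := S) (f := fun i => ⟨f i, hfS i⟩)
    (g := fun i => ⟨g i, hgS i⟩) (fun i j h => hf (congrArg Subtype.val h))
    (fun i j h => hg (congrArg Subtype.val h))
  obtain ⟨τ, h1, h2, h3⟩ := exists_reach_color_perm (c := c) hS π σ
  exact ⟨τ, h1, fun i => by rw [h2 ⟨f i, hfS i⟩, hπ], h3⟩

/-- The tokens that are not of colour `A` can be moved to any prescribed set of positions
inside a connected set containing them. -/
theorem exists_reach_support {S : Set V} (hS : (X.induce S).Preconnected) {A : ι} {σ : Perm V}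
    (hσ : ∀ x, c (σ x) ≠ A → x ∈ S) {N : Finset V} (hN : (N : Set V) ⊆ S)
    (hcard : N.card = Nat.card {x // c x ≠ A}) :
    ∃ τ, Reach X c σ τ ∧ (∀ x, c (τ x) ≠ A ↔ x ∈ N) ∧ ∀ x ∉ S, τ x = σ x := by
  classical
  have := Fintype.ofFinite V
  have hc' : Nat.card N = Nat.card {x // c x ≠ A} := by
    rw [← hcard, Nat.card_eq_fintype_card, Fintype.card_coe]
  let e : N ≃ {x // c x ≠ A} := (Finite.card_eq.1 hc').some
  obtain ⟨τ, h1, h2, h3⟩ := exists_reach_color (c := c) hS (f := fun x : N => (x : V))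
    (g := fun x : N => σ.symm (e x)) Subtype.val_injective
    (fun x y h => e.injective (Subtype.ext (σ.symm.injective h))) (fun x => hN x.2)
    (fun x => hσ _ (by rw [apply_symm_apply]; exact (e x).2)) σ
  have h4 : ∀ x ∈ N, c (τ x) ≠ A := fun x hx => by
    rw [h2 ⟨x, hx⟩, apply_symm_apply]; exact (e ⟨x, hx⟩).2
  -- `N` is filled with tokens not coloured `A` and has as many elements as there are such tokens,
  -- so none is elsewhere.
  have h5 : N = Finset.univ.filter fun x => c (τ x) ≠ A := by
    refine Finset.eq_of_subset_of_card_le (fun x hx => by simpa using h4 x hx) ?_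
    rw [hcard, Nat.card_eq_fintype_card, Fintype.card_subtype]
    refine Finset.card_le_card_of_injOn τ (fun x hx => ?_) τ.injective.injOn
    simp only [Finset.mem_coe, Finset.mem_filter, Finset.mem_univ, true_and] at hx ⊢
    exact hx
  refine ⟨τ, h1, fun x => ⟨fun hx => ?_, h4 x⟩, h3⟩
  rw [h5]; simpa using hx

end Rearrange

/-! ### A token walking along a path. -/

section Bubble

variable {V ι : Type*} [DecidableEq V] {X : SimpleGraph V} {c : V → ι}

/-- A token walks along a path all of whose other tokens have different colours. -/
theorem reach_formPerm {x : V} {l : List V} (hl : (x :: l).IsChain X.Adj) (hd : (x :: l).Nodup)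
    {σ : Perm V} (h : ∀ y ∈ l, c (σ y) ≠ c (σ x)) : Reach X c σ (σ * (x :: l).formPerm) := by
  induction l generalizing x σ with
  | nil => simpa using Reach.refl σ
  | cons y l ih =>
    rw [List.formPerm_cons_cons, ← mul_assoc]
    rw [List.isChain_cons_cons] at hl
    rw [List.nodup_cons] at hd
    refine (Reach.swap hl.1 (h y (by simp)).symm).trans (ih hl.2 hd.2 ?_)
    intro z hz
    have hzx : z ≠ x := fun e => hd.1 (by simp [← e, hz])
    have hzy : z ≠ y := fun e => (List.nodup_cons.1 hd.2).1 (by simp [← e, hz])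
    simpa [swap_apply_of_ne_of_ne hzx hzy] using h z (by simp [hz])

end Bubble

/-! ### Interchanging like tokens up to a subgroup. -/

section Swappable

variable {V ι : Type*} [DecidableEq V] {X : SimpleGraph V} {c : V → ι} {A : ι}
  {K : Subgroup (Perm V)} {σ τ : Perm V} {p q r : V}

/-- The tokens `p` and `q` can be interchanged by moves from `σ`, up to a relabelling of the
tokens that belongs to `K`. -/
def Swappable (X : SimpleGraph V) (c : V → ι) (K : Subgroup (Perm V)) (σ : Perm V) (p q : V) :
    Prop :=
  ∃ β ∈ K, β * swap p q ∈ realized X c σ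

/-- The elements of `K` preserve all colours and fix the tokens of colour `A`. -/
def FixesColor (c : V → ι) (A : ι) (K : Subgroup (Perm V)) : Prop :=
  ∀ β ∈ K, (∀ x, c (β x) = c x) ∧ ∀ x, c x = A → β x = x

theorem FixesColor.commute_swap (hK : FixesColor c A K) (hp : c p = A) (hq : c q = A)
    {β : Perm V} (hβ : β ∈ K) : Commute (swap p q) β := by
  have h1 := (hK β hβ).2 p hp
  have h2 := (hK β hβ).2 q hq
  have := mul_swap_eq_swap_mul β p q
  rw [h1, h2] at this
  exact this.symm

theorem Swappable.refl (σ : Perm V) (p : V) : Swappable X c K σ p p :=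
  ⟨1, K.one_mem, by rw [swap_self]; exact (realized X c σ).one_mem⟩

theorem Swappable.symm (h : Swappable X c K σ p q) : Swappable X c K σ q p := by
  rwa [Swappable, swap_comm]

theorem Swappable.trans (hK : FixesColor c A K) (hp : c p = A) (hq : c q = A) (hr : c r = A)
    (h : Swappable X c K σ p q) (h' : Swappable X c K σ q r) : Swappable X c K σ p r := by
  rcases eq_or_ne p r with rfl | hpr
  · exact Swappable.refl σ p
  rcases eq_or_ne p q with rfl | hpq
  · exact h'
  rcases eq_or_ne q r with rfl | hqr
  · exact h
  obtain ⟨β, hβ, h1⟩ := h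
  obtain ⟨γ, hγ, h2⟩ := h'
  -- Write `swap p r` as `swap p q * swap q r * swap p q`. Elements of `K` fix the `A` tokens and so
  -- commute with these swaps, which lets each factor take up its own correction.
  refine ⟨β * γ * β, K.mul_mem (K.mul_mem hβ hγ) hβ, ?_⟩
  have e : β * γ * β * swap p r = β * swap p q * (γ * swap q r) * (β * swap p q) := by
    have c1 := (hK.commute_swap hp hq hγ).eq
    have c2 := (hK.commute_swap hq hr hβ).eq
    have c3 := (hK.commute_swap hp hq hβ).eq
    have e1 : swap p r = swap p q * swap q r * swap p q := by
      rw [swap_comm p q, swap_comm q r, swap_mul_swap_mul_swap hqr.symm hpr.symm]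
    calc β * γ * β * swap p r = β * γ * (β * swap p q) * swap q r * swap p q := by
          rw [e1]; simp only [mul_assoc]
      _ = β * (γ * swap p q) * (β * swap q r) * swap p q := by
          rw [← c3]; simp only [mul_assoc]
      _ = _ := by rw [← c1, ← c2]; simp only [mul_assoc]
  rw [e]
  exact mul_mem (mul_mem h1 h2) h1

theorem Swappable.of_reach (h : Reach X c σ τ) (h' : Swappable X c K τ p q) :
    Swappable X c K σ p q := by
  rwa [Swappable, h.realized_eq]

end Swappable

theorem symm_apply_mem {V : Type*} {σ τ : Perm V} {S : Set V} (h : ∀ x ∉ S, τ x = σ x) {x : V}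
    (hx : x ∈ S) : σ.symm (τ x) ∈ S := by
  by_contra hx'
  have h1 := h _ hx'
  rw [apply_symm_apply] at h1
  exact hx' ((τ.injective h1).symm ▸ hx)

theorem formPerm_support_apply_end {V : Type*} [DecidableEq V] {X : SimpleGraph V}
    {u w : V} (p : X.Walk u w) : p.support.formPerm w = u := by
  have h := List.formPerm_apply_getLast u p.support.tail
  have e := p.cons_tail_support.symm
  simp only [← e] at h
  simpa using h

/-! ### Exchanging tokens at a branch vertex. -/

section Exchange

variable {V ι : Type*} [DecidableEq V] {X : SimpleGraph V} {c : V → ι} {A : ι} {S : Finset V}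
  {σ : Perm V}

/-- A token is brought along a path to a branch vertex `u`, exchanged for another one there, which
is then brought back along the path. -/
theorem reach_exchange {u w u₁ u₂ : V} (p : X.Walk u w) (hp : p.IsPath)
    (h₁ : X.Adj u u₁) (h₂ : X.Adj u u₂) (h₁₂ : u₁ ≠ u₂) (hp₁ : u₁ ∉ p.support)
    (hp₂ : u₂ ∉ p.support) (hw : c (σ w) = A) (hu₂ : c (σ u₂) = A) (hu₁ : c (σ u₁) ≠ A)
    (hne : ∀ x ∈ p.support, x ≠ w → c (σ x) ≠ A) :
    Reach X c σ (σ * swap w u₁ * swap w u₂) := by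
  set f := p.support.formPerm with hf
  have hfw : f w = u := formPerm_support_apply_end p
  have hfw' : f⁻¹ u = w := by rw [← hfw]; simp
  have hf₁ : f⁻¹ u₁ = u₁ := by
    rw [Perm.inv_eq_iff_eq, List.formPerm_apply_of_notMem hp₁]
  have hf₂ : f⁻¹ u₂ = u₂ := by
    rw [Perm.inv_eq_iff_eq, List.formPerm_apply_of_notMem hp₂]
  have hfmem : ∀ x ∈ p.support, f⁻¹ x ∈ p.support := by
    intro x hx
    have := List.formPerm_mem_iff_mem (l := p.support) (x := f⁻¹ x)
    rw [← this, ← hf]; simpa using hx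
  have hrev : p.reverse.support.formPerm = f⁻¹ := by
    rw [SimpleGraph.Walk.support_reverse, List.formPerm_reverse]
  -- The token from `w` walks to `u` and steps aside to `u₁`, displacing a token of another colour
  -- to `u`; the latter changes places with the `A` token at `u₂`, which walks back to `w`.
  have s1 : Reach X c σ (σ * f⁻¹) := by
    rw [← hrev, ← p.reverse.cons_tail_support]
    have hn := hp.reverse.support_nodup
    have hc := p.reverse.isChain_adj_support
    rw [← p.reverse.cons_tail_support] at hn hc
    refine reach_formPerm hc hn fun y hy => ?_
    rw [hw]
    refine hne y ?_ ?_
    · have : y ∈ p.reverse.support := by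
        rw [← p.reverse.cons_tail_support]; exact List.mem_cons_of_mem _ hy
      simpa using this
    · rintro rfl
      exact (List.nodup_cons.1 hn).1 hy
  have hu₁' : u₁ ≠ u := h₁.ne'
  have hu₂' : u₂ ≠ u := h₂.ne'
  have s2 : Reach X c (σ * f⁻¹) (σ * f⁻¹ * swap u u₁) := by
    refine Reach.swap h₁ ?_
    simp only [Perm.mul_apply, hfw', hf₁, hw]
    exact hu₁.symm
  have s3 : Reach X c (σ * f⁻¹ * swap u u₁) (σ * f⁻¹ * swap u u₁ * swap u u₂) := by
    refine Reach.swap h₂ ?_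
    simp only [Perm.mul_apply, swap_apply_left, hf₁, swap_apply_of_ne_of_ne hu₂' h₁₂.symm, hf₂, hu₂]
    exact hu₁
  have s4 : Reach X c (σ * f⁻¹ * swap u u₁ * swap u u₂)
      (σ * f⁻¹ * swap u u₁ * swap u u₂ * f) := by
    rw [hf, ← p.cons_tail_support]
    have hn := hp.support_nodup
    have hc := p.isChain_adj_support
    rw [← p.cons_tail_support] at hn hc
    refine reach_formPerm hc hn fun y hy => ?_
    rw [p.cons_tail_support, ← hf]
    have hyp : y ∈ p.support := by rw [← p.cons_tail_support]; exact List.mem_cons_of_mem _ hy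
    have hyu : y ≠ u := by rintro rfl; exact (List.nodup_cons.1 hn).1 hy
    have hy₁ : y ≠ u₁ := by rintro rfl; exact hp₁ hyp
    have hy₂ : y ≠ u₂ := by rintro rfl; exact hp₂ hyp
    simp only [Perm.mul_apply, swap_apply_left, hf₂, swap_apply_of_ne_of_ne hu₂' h₁₂.symm,
      swap_apply_of_ne_of_ne hyu hy₁, swap_apply_of_ne_of_ne hyu hy₂, hu₂]
    refine hne _ (hfmem y hyp) ?_
    rw [← hfw']
    exact f⁻¹.injective.ne hyu
  have e : σ * f⁻¹ * swap u u₁ * swap u u₂ * f = σ * swap w u₁ * swap w u₂ := by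
    have e1 : f⁻¹ * swap u u₁ = swap w u₁ * f⁻¹ := by rw [mul_swap_eq_swap_mul, hfw', hf₁]
    have e2 : f⁻¹ * swap u u₂ = swap w u₂ * f⁻¹ := by rw [mul_swap_eq_swap_mul, hfw', hf₂]
    rw [mul_assoc σ, e1, mul_assoc σ, mul_assoc (swap w u₁), e2]
    simp [mul_assoc]
  exact e ▸ ((s1.trans s2).trans s3).trans s4

theorem preconnected_induce_union_support (hS : (X.induce (S : Set V)).Preconnected) {u w : V}
    (hu : u ∈ S) (p : X.Walk u w) :
    (X.induce ((S ∪ p.support.toFinset : Finset V) : Set V)).Preconnected := by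
  have h2 := p.connected_induce_support
  have := SimpleGraph.induce_union_connected hS h2.preconnected ⟨u, hu, p.start_mem_support⟩
  have e : ((S ∪ p.support.toFinset : Finset V) : Set V) = ↑S ∪ {v | v ∈ p.support} := by
    ext; simp
  rw [e]
  exact this.preconnected

end Exchange

/-! ### Good sets and their enlargement. -/

section Good

variable {V ι : Type*} [DecidableEq V] [Fintype V] {X : SimpleGraph V} {c : V → ι} {A : ι}
  {K : Subgroup (Perm V)} {S : Finset V} {σ τ : Perm V}

/-- Whenever all tokens of colours other than `A` lie in `S`, all the other tokens in `S` are
swappable. -/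
def IsGood (X : SimpleGraph V) (c : V → ι) (A : ι) (K : Subgroup (Perm V)) (S : Finset V) : Prop :=
  ∀ σ : Perm V, (∀ x, c (σ x) ≠ A → x ∈ S) → ∀ x ∈ S, ∀ y ∈ S, c (σ x) = A → c (σ y) = A →
    Swappable X c K σ (σ x) (σ y)

/-- The surplus of two positions leaves a spare `A` token in `S` even after one position is
excluded. It serves as a partner that the manoeuvres do not disturb. -/
theorem exists_mem_color_eq (σ : Perm V) (hcard : Nat.card {x // c x ≠ A} + 2 ≤ S.card) (x : V) :
    ∃ z ∈ S, z ≠ x ∧ c (σ z) = A := by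
  classical
  by_contra! h
  have hsub : S ⊆ insert x (Finset.univ.filter fun z => c (σ z) ≠ A) := by
    intro z hz
    rcases eq_or_ne z x with rfl | hzx
    · simp
    · simpa using Or.inr (h z hz hzx)
  have h1 := (Finset.card_le_card hsub).trans (Finset.card_insert_le _ _)
  have h2 : (Finset.univ.filter fun z => c (σ z) ≠ A).card ≤ Nat.card {x // c x ≠ A} := by
    rw [Nat.card_eq_fintype_card, Fintype.card_subtype]
    refine Finset.card_le_card_of_injOn σ (fun x hx => ?_) σ.injective.injOn
    simp only [Finset.mem_coe, Finset.mem_filter, Finset.mem_univ, true_and] at hx ⊢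
    exact hx
  omega

/-- Connectedness of `T` allows all tokens not coloured `A` to be gathered in `S`. Each `A` token
outside `S` is then swappable with one inside, and goodness of `S` links the latter. -/
theorem IsGood.extend (hK : FixesColor c A K) (hgood : IsGood X c A K S)
    (hcard : Nat.card {x // c x ≠ A} + 2 ≤ S.card) {T : Finset V} (hST : S ⊆ T)
    (hT : (X.induce (T : Set V)).Preconnected)
    (h : ∀ σ : Perm V, (∀ x, c (σ x) ≠ A → x ∈ S) → ∀ x ∈ T, x ∉ S → c (σ x) = A →
      ∃ y ∈ S, c (σ y) = A ∧ Swappable X c K σ (σ x) (σ y)) : IsGood X c A K T := by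
  intro σ hσ x hx y hy hxA hyA
  obtain ⟨N, hNS, hN⟩ := Finset.exists_subset_card_eq (s := S) (n := Nat.card {x // c x ≠ A})
    (by omega)
  obtain ⟨τ, h1, h2, h3⟩ := exists_reach_support (c := c) hT (A := A) (σ := σ) hσ
    (N := N) (fun z hz => hST (hNS hz)) hN
  have hτ : ∀ x, c (τ x) ≠ A → x ∈ S := fun x hx => hNS ((h2 x).1 hx)
  have h3' : ∀ x ∉ (T : Set V), σ x = τ x := fun x hx => (h3 x hx).symm
  have h4 : ∀ x ∈ T, c (σ x) = A → ∃ y ∈ S, c (τ y) = A ∧ Swappable X c K τ (σ x) (τ y) := by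
    intro x hx hxA
    have hm : τ.symm (σ x) ∈ T := symm_apply_mem (S := (T : Set V)) h3' hx
    by_cases hS : τ.symm (σ x) ∈ S
    · exact ⟨_, hS, by simpa using hxA, by simpa using Swappable.refl _ _⟩
    · simpa using h τ hτ _ hm hS (by simpa using hxA)
  obtain ⟨x', hx', hxA', hxs⟩ := h4 x hx hxA
  obtain ⟨y', hy', hyA', hys⟩ := h4 y hy hyA
  exact .of_reach h1 ((hxs.trans hK hxA hxA' hyA' (hgood τ hτ x' hx' y' hy' hxA' hyA')).trans
    hK hxA hyA' hyA hys.symm)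

/-- A good set remains good when a vertex is added from which a sufficiently short path leads to a
branch vertex of the set. -/
theorem IsGood.union_pendant (hK : FixesColor c A K) (hgood : IsGood X c A K S)
    (hS : (X.induce (S : Set V)).Preconnected)
    (hcard : Nat.card {x // c x ≠ A} + 2 ≤ S.card) {u w u₁ u₂ : V} (p : X.Walk u w)
    (hp : p.IsPath) (hw : w ∉ S) (hpS : ∀ x ∈ p.support, x ≠ w → x ∈ S)
    (h₁ : X.Adj u u₁) (h₂ : X.Adj u u₂) (h₁₂ : u₁ ≠ u₂) (hp₁ : u₁ ∉ p.support)
    (hp₂ : u₂ ∉ p.support) (hS₁ : u₁ ∈ S) (hS₂ : u₂ ∈ S) (hpos : u ≠ w)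
    (hlen : p.length + 1 ≤ Nat.card {x // c x ≠ A}) :
    IsGood X c A K (S ∪ p.support.toFinset) := by
  refine hgood.extend hK hcard Finset.subset_union_left
    (preconnected_induce_union_support hS (hpS u p.start_mem_support hpos) p) ?_
  intro σ hσ x hx hxS hxA
  obtain rfl : x = w := by
    by_contra hne
    simp only [Finset.mem_union, List.mem_toFinset] at hx
    exact hxS (hpS x (hx.resolve_left hxS) hne)
  -- These positions must hold tokens not coloured `A`: the path without its end has at most
  -- `p.length` vertices, and `u₁` adds one, whence the bound `hlen`.
  set P := insert u₁ (p.support.toFinset.erase x) with hP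
  have hPc : P.card ≤ p.length + 1 := by
    refine (Finset.card_insert_le _ _).trans ?_
    rw [Finset.card_erase_of_mem (by simp)]
    have := List.toFinset_card_le p.support
    rw [SimpleGraph.Walk.length_support] at this
    omega
  have hPS : P ⊆ S.erase u₂ := by
    intro z hz
    simp only [hP, Finset.mem_insert, Finset.mem_erase, List.mem_toFinset] at hz ⊢
    rcases hz with rfl | ⟨hzx, hz⟩
    · exact ⟨h₁₂, hS₁⟩
    · exact ⟨by rintro rfl; exact hp₂ hz, hpS z hz hzx⟩
  obtain ⟨N, hPN, hNS, hN⟩ := Finset.exists_subsuperset_card_eq hPS (hPc.trans hlen)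
    (by rw [Finset.card_erase_of_mem hS₂]; omega)
  obtain ⟨τ, r1, hτ, hoff⟩ := exists_reach_support (c := c) hS (A := A) (σ := σ) hσ
    (N := N) (fun z hz => Finset.mem_of_mem_erase (hNS hz)) hN
  have hNA : ∀ z, c (τ z) = A ↔ z ∉ N := fun z => by rw [← hτ z]; tauto
  have hx' : τ x = σ x := hoff x hxS
  have hxA' : c (τ x) = A := by rwa [hx']
  have hu₂ : c (τ u₂) = A := by rw [hNA]; exact fun h => by simpa using hNS h
  have hu₁ : c (τ u₁) ≠ A := by rw [hτ]; exact hPN (by simp [hP])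
  have r2 := reach_exchange (c := c) (A := A) (σ := τ) p hp h₁ h₂ h₁₂ hp₁ hp₂ hxA' hu₂ hu₁
    (fun z hz hzx => (hτ z).2 (hPN (by simp [hP, hz, hzx])))
  set υ := τ * swap x u₁ * swap x u₂ with hυ
  have hxu₁ : u₁ ≠ x := by rintro rfl; exact hxS hS₁
  have hxu₂ : u₂ ≠ x := by rintro rfl; exact hxS hS₂
  have υ1 : υ u₁ = τ x := by simp [hυ, swap_apply_of_ne_of_ne hxu₁ h₁₂]
  have υx : υ x = τ u₂ := by simp [hυ, swap_apply_of_ne_of_ne hxu₂ h₁₂.symm]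
  -- The exchange has put the outside token at `u₁`, inside `S`; goodness now links it to an `A`
  -- token that stayed in place.
  obtain ⟨z, hzS, hz2, hzA⟩ := exists_mem_color_eq (c := c) τ hcard u₂
  have hz1 : z ≠ u₁ := by rintro rfl; exact hu₁ hzA
  have hzx : z ≠ x := by rintro rfl; exact hxS hzS
  have υz : υ z = τ z := by
    simp [hυ, swap_apply_of_ne_of_ne hzx hz2, swap_apply_of_ne_of_ne hzx hz1]
  have hυS : ∀ y, c (υ y) ≠ A → y ∈ S := by
    intro y hy
    by_cases hyx : y = x
    · rw [hyx, υx] at hy; exact absurd hu₂ hy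
    · by_contra hyS
      have hy1 : y ≠ u₁ := by rintro rfl; exact hyS hS₁
      have hy2 : y ≠ u₂ := by rintro rfl; exact hyS hS₂
      have : υ y = τ y := by
        simp [hυ, swap_apply_of_ne_of_ne hyx hy2, swap_apply_of_ne_of_ne hyx hy1]
      rw [this, hτ] at hy
      exact hyS (Finset.mem_of_mem_erase (hNS hy))
  have key := hgood υ hυS u₁ hS₁ z hzS (by rwa [υ1]) (by rwa [υz])
  rw [υ1, υz, hx'] at key
  refine ⟨σ.symm (τ z), symm_apply_mem (S := (S : Set V)) hoff hzS, by simpa using hzA, ?_⟩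
  rw [apply_symm_apply]
  exact .of_reach (r1.trans r2) key

/-- A good set remains good when an ear with two distinct end vertices is added. -/
theorem IsGood.union_ear (hK : FixesColor c A K) (hgood : IsGood X c A K S)
    (hS : (X.induce (S : Set V)).Preconnected)
    (hcard : Nat.card {x // c x ≠ A} + 2 ≤ S.card) (hpos : 1 ≤ Nat.card {x // c x ≠ A})
    {a b : V} (p : X.Walk b a) (hp : p.IsPath) (hab : a ≠ b) (ha : a ∈ S) (hb : b ∈ S)
    (hint : ∀ x ∈ p.support, x ∈ S → x = a ∨ x = b) :
    IsGood X c A K (S ∪ p.support.toFinset) := by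
  have hl0 := p.cons_tail_support.symm
  have hpn := hp.support_nodup
  have hpc := p.isChain_adj_support
  have hfb : p.support.formPerm a = b := formPerm_support_apply_end p
  set l := p.support with hl
  have hbl : b ∈ l := by rw [hl0]; simp
  have hal : a ∈ l := p.end_mem_support
  have hl00 : ∀ h : 0 < l.length, l[0] = b := fun h => List.getElem_of_eq hl0 h
  -- Induction on the distance along the ear from `b`: one rotation of the ear brings the token at
  -- `l[i + 1]` to `l[i]`.
  have key : ∀ (i : ℕ) (hi : i < l.length) (σ : Perm V), (∀ x, c (σ x) ≠ A → x ∈ S) →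
      c (σ l[i]) = A → ∃ y ∈ S, c (σ y) = A ∧ Swappable X c K σ (σ l[i]) (σ y) := by
    intro i
    induction i with
    | zero =>
      intro hi σ _ hA
      exact ⟨_, by rw [hl00]; exact hb, hA, Swappable.refl _ _⟩
    | succ i ih =>
      intro hi σ hσ hA
      by_cases hiS : l[i + 1] ∈ S
      · exact ⟨_, hiS, hA, Swappable.refl _ _⟩
      -- On the ear only `b` gets a token not coloured `A`. It travels from `b` to `a`, shifting all
      -- others by one, and ends in `S`, so the hypothesis on `σ` persists.
      obtain ⟨N, hbN, hNS, hN⟩ := Finset.exists_subsuperset_card_eq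
        (s := {b}) (t := S.erase a) (n := Nat.card {x // c x ≠ A})
        (by simp [hb, hab.symm]) (by simpa using hpos)
        (by rw [Finset.card_erase_of_mem ha]; omega)
      obtain ⟨τ, r1, hτ, hoff⟩ := exists_reach_support (c := c) hS (A := A) (σ := σ) hσ
        (N := N) (fun z hz => Finset.mem_of_mem_erase (hNS hz)) hN
      have hbN' : b ∈ N := hbN (by simp)
      have hNl : ∀ x ∈ l, x ∈ N → x = b := fun x hx hxN =>
        (hint x hx (Finset.mem_of_mem_erase (hNS hxN))).resolve_left
          (Finset.ne_of_mem_erase (hNS hxN))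
      have hNA : ∀ z, c (τ z) = A ↔ z ∉ N := fun z => by rw [← hτ z]; tauto
      have r2 : Reach X c τ (τ * l.formPerm) := by
        rw [hl0] at hpc hpn ⊢
        refine reach_formPerm hpc hpn fun y hy => ?_
        have hyb : y ≠ b := by rintro rfl; exact (List.nodup_cons.1 hpn).1 hy
        have : c (τ y) = A := by
          rw [hNA]
          exact fun hyN => hyb (hNl y (by rw [hl0]; exact List.mem_cons_of_mem _ hy) hyN)
        rw [this]
        exact ((hτ b).2 hbN').symm
      set υ := τ * l.formPerm with hυ
      have hυi : υ l[i] = σ l[i + 1] := by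
        rw [hυ, Perm.mul_apply, List.formPerm_apply_lt_getElem _ hpn _ hi, hoff _ hiS]
      have hυS : ∀ x, c (υ x) ≠ A → x ∈ S := by
        intro x hx
        rw [hυ, Perm.mul_apply, hτ] at hx
        by_cases hxl : x ∈ l
        · have h1 := hNl _ (List.formPerm_apply_mem_of_mem hxl) hx
          rw [← hfb] at h1
          rw [l.formPerm.injective h1]; exact ha
        · rw [List.formPerm_apply_of_notMem hxl] at hx
          exact Finset.mem_of_mem_erase (hNS hx)
      obtain ⟨q, hqS, hqA, hq⟩ := ih (by omega) υ hυS (by rwa [hυi])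
      obtain ⟨z, hzS, hza, hzA⟩ := exists_mem_color_eq (c := c) τ hcard a
      have hzb : z ≠ b := by rintro rfl; exact (hτ z).2 hbN' hzA
      have hzl : z ∉ l := fun h => (hint z h hzS).elim hza hzb
      have υz : υ z = τ z := by
        rw [hυ, Perm.mul_apply, List.formPerm_apply_of_notMem hzl]
      have h2 := hgood υ hυS q hqS z hzS hqA (by rwa [υz])
      have h3 := hq.trans hK (by rwa [hυi]) hqA (by rwa [υz]) h2
      rw [hυi, υz] at h3
      refine ⟨σ.symm (τ z), symm_apply_mem (S := (S : Set V)) hoff hzS, by simpa using hzA, ?_⟩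
      rw [apply_symm_apply]
      exact .of_reach (r1.trans r2) h3
  refine hgood.extend hK hcard Finset.subset_union_left
    (preconnected_induce_union_support hS hb p) ?_
  intro σ hσ x hx hxS hxA
  simp only [Finset.mem_union, List.mem_toFinset] at hx
  obtain ⟨i, hi, rfl⟩ := List.getElem_of_mem (hx.resolve_left hxS)
  exact key i hi σ hσ hxA

end Good

theorem injective_vec_four {α : Type*} {a b c d : α} (hab : a ≠ b) (hac : a ≠ c) (had : a ≠ d)
    (hbc : b ≠ c) (hbd : b ≠ d) (hcd : c ≠ d) : Function.Injective ![a, b, c, d] := by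
  intro i j h
  fin_cases i <;> fin_cases j <;> simp_all [eq_comm]

/-! ### The base case: sets containing a claw. -/

section Claw

variable {V ι : Type*} [DecidableEq V] {X : SimpleGraph V} {c : V → ι} {A : ι}
  {σ : Perm V} {o x y z : V}

/-- On a claw, two tokens of the same colour and two other tokens can be interchanged
simultaneously. -/
theorem reach_claw (hx : X.Adj o x) (hy : X.Adj o y) (hz : X.Adj o z) (hxy : x ≠ y) (hxz : x ≠ z)
    (hyz : y ≠ z) (ho : c (σ o) = A) (hcx : c (σ x) = A) (hcy : c (σ y) ≠ A) (hcz : c (σ z) ≠ A) :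
    Reach X c σ (σ * swap y z * swap o x) := by
  have hox := hx.ne
  have hoy := hy.ne
  have hoz := hz.ne
  -- Each of the six moves exchanges an `A` token with another one, so the two other tokens may have
  -- the same colour.
  have e : σ * swap o y * swap o x * swap o z * swap o y * swap o x * swap o z =
      σ * swap y z * swap o x := by
    ext w
    by_cases h1 : w = o
    · subst h1; simp [swap_apply_def, *, Ne.symm]
    by_cases h2 : w = x
    · subst h2; simp [swap_apply_def, *, Ne.symm]
    by_cases h3 : w = y
    · subst h3; simp [swap_apply_def, *, Ne.symm]
    by_cases h4 : w = z
    · subst h4; simp [swap_apply_def, *, Ne.symm]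
    simp [swap_apply_def, *]
  rw [← e]
  refine ((((Reach.swap hy ?_).trans (.swap hx ?_)).trans (.swap hz ?_)).trans
    (.swap hy ?_)).trans (.swap hx ?_) |>.trans (.swap hz ?_)
  all_goals simp [swap_apply_def, *, Ne.symm, hcy.symm, hcz.symm, hox.symm, hoy.symm, hoz.symm,
    hxy.symm, hxz.symm, hyz.symm]

/-- On a claw, two tokens of the same colour can be interchanged if the other two tokens have two
further colours. -/
theorem reach_claw_of_ne (hx : X.Adj o x) (hy : X.Adj o y) (hz : X.Adj o z) (hxy : x ≠ y)
    (hxz : x ≠ z) (hyz : y ≠ z) (ho : c (σ o) = A) (hcx : c (σ x) = A) (hcy : c (σ y) ≠ A)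
    (hcz : c (σ z) ≠ A) (hcyz : c (σ y) ≠ c (σ z)) :
    Reach X c σ (σ * swap o x) := by
  have hox := hx.ne
  have hoy := hy.ne
  have hoz := hz.ne
  refine (reach_claw hx hy hz hxy hxz hyz ho hcx hcy hcz).trans ?_
  -- The moves `y`, `z`, `y` through the centre compose to `swap y z` and undo the side effect; the
  -- middle one needs the two further colours to differ.
  have e : σ * swap y z * swap o x * swap o y * swap o z * swap o y = σ * swap o x := by
    ext w
    by_cases h1 : w = o
    · subst h1; simp [swap_apply_def, *, Ne.symm]
    by_cases h2 : w = x
    · subst h2; simp [swap_apply_def, *, Ne.symm]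
    by_cases h3 : w = y
    · subst h3; simp [swap_apply_def, *, Ne.symm]
    by_cases h4 : w = z
    · subst h4; simp [swap_apply_def, *, Ne.symm]
    simp [swap_apply_def, *]
  rw [← e]
  refine ((Reach.swap hy ?_).trans (.swap hz ?_)).trans (.swap hy ?_)
  all_goals simp [swap_apply_def, *, Ne.symm, hcz.symm, hoy.symm, hoz.symm,
    hxy.symm, hxz.symm, hyz.symm, hcyz.symm]

variable [Fintype V] {K : Subgroup (Perm V)} {S : Finset V}

/-- With exactly two surplus positions, `S` holds only two `A` tokens. This identifies the tokens
placed on the claw although rearrangement controls only colours. -/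
theorem eq_or_eq_of_card (hσ : ∀ x, c (σ x) ≠ A → x ∈ S)
    (hcard : S.card = Nat.card {x // c x ≠ A} + 2) (hx : x ∈ S) (hy : y ∈ S) (hz : z ∈ S)
    (hxA : c (σ x) = A) (hyA : c (σ y) = A) (hzA : c (σ z) = A) (hxy : x ≠ y) :
    z = x ∨ z = y := by
  classical
  by_contra! h
  have h2 : Nat.card {x // c x ≠ A} ≤ (S.filter fun z => ¬ c (σ z) = A).card := by
    rw [Nat.card_eq_fintype_card, Fintype.card_subtype]
    refine Finset.card_le_card_of_injOn σ.symm (fun x hx => ?_) σ.symm.injective.injOn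
    simp only [Finset.mem_coe, Finset.mem_filter, Finset.mem_univ, true_and,
      apply_symm_apply] at hx ⊢
    exact ⟨hσ _ (by simpa using hx), hx⟩
  have h3 : ({x, y, z} : Finset V) ⊆ S.filter fun z => c (σ z) = A := by
    intro w hw
    simp only [Finset.mem_insert, Finset.mem_singleton] at hw
    rcases hw with rfl | rfl | rfl <;> simp [*]
  have h4 := Finset.card_le_card h3
  rw [Finset.card_eq_three.2 ⟨x, y, z, hxy, h.1.symm, h.2.symm, rfl⟩] at h4
  have h5 := Finset.card_filter_add_card_filter_not (s := S) (fun z => c (σ z) = A)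
  omega

/-- A connected set that contains a claw is good if it has only two positions more than there are
tokens of colours other than `A`. -/
theorem isGood_of_claw (hK : FixesColor c A K)
    (hB : (∃ b₁ b₂, c b₁ ≠ A ∧ c b₂ ≠ A ∧ c b₁ ≠ c b₂) ∨
      ∀ b₁ b₂, c b₁ ≠ A → c b₂ ≠ A → swap b₁ b₂ ∈ K)
    (hmA : 2 ≤ Nat.card {x // c x ≠ A})
    (hS : (X.induce (S : Set V)).Preconnected) (hcard : S.card = Nat.card {x // c x ≠ A} + 2)
    (hx : X.Adj o x) (hy : X.Adj o y) (hz : X.Adj o z) (hxy : x ≠ y) (hxz : x ≠ z)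
    (hyz : y ≠ z) (hoS : o ∈ S) (hxS : x ∈ S) (hyS : y ∈ S) (hzS : z ∈ S) :
    IsGood X c A K S := by
  have hox := hx.ne
  have hoy := hy.ne
  have hoz := hz.ne
  intro σ hσ p hp q hq hpA hqA
  rcases eq_or_ne p q with rfl | hpq
  · exact Swappable.refl _ _
  obtain ⟨b₁, b₂, hb₁, hb₂, hb, hbK⟩ : ∃ b₁ b₂, c b₁ ≠ A ∧ c b₂ ≠ A ∧ b₁ ≠ b₂ ∧
      (c b₁ ≠ c b₂ ∨ ∀ b₁ b₂, c b₁ ≠ A → c b₂ ≠ A → swap b₁ b₂ ∈ K) := by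
    rcases hB with ⟨b₁, b₂, h1, h2, h3⟩ | h
    · exact ⟨b₁, b₂, h1, h2, fun e => h3 (by rw [e]), Or.inl h3⟩
    · have : Nontrivial {x // c x ≠ A} := Finite.one_lt_card_iff_nontrivial.1 hmA
      obtain ⟨b₁, b₂, hb⟩ := exists_pair_ne {x // c x ≠ A}
      exact ⟨b₁, b₂, b₁.2, b₂.2, fun e => hb (Subtype.ext e), Or.inr h⟩
  have hb₁S : σ.symm b₁ ∈ S := hσ _ (by simpa using hb₁)
  have hb₂S : σ.symm b₂ ∈ S := hσ _ (by simpa using hb₂)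
  have hne : ∀ w b, c (σ w) = A → c b ≠ A → w ≠ σ.symm b := by
    rintro w b hw hb rfl
    exact hb (by simpa using hw)
  have hf : Function.Injective ![o, x, y, z] := injective_vec_four hox hoy hoz hxy hxz hyz
  have hg : Function.Injective ![p, q, σ.symm b₁, σ.symm b₂] :=
    injective_vec_four hpq (hne p b₁ hpA hb₁) (hne p b₂ hpA hb₂) (hne q b₁ hqA hb₁)
      (hne q b₂ hqA hb₂) (σ.symm.injective.ne hb)
  obtain ⟨τ, r, hτ, hoff⟩ := exists_reach_color (c := c) hS hf hg
    (by intro i; fin_cases i <;> simpa) (by intro i; fin_cases i <;> simpa) σ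
  have c0 : c (τ o) = A := (hτ 0).trans hpA
  have c1 : c (τ x) = A := (hτ 1).trans hqA
  have c2 : c (τ y) = c b₁ := (hτ 2).trans (congrArg c (σ.apply_symm_apply b₁))
  have c3 : c (τ z) = c b₂ := (hτ 3).trans (congrArg c (σ.apply_symm_apply b₂))
  have c2' : c (τ y) ≠ A := by rwa [c2]
  have c3' : c (τ z) ≠ A := by rwa [c3]
  -- Either the two further colours differ and the swap is exact, or the accompanying transposition
  -- lies in `K`.
  have key : Swappable X c K τ (τ o) (τ x) := by
    rcases hbK with hcb | hbK
    · refine ⟨1, K.one_mem, ?_⟩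
      rw [one_mul, mem_realized]
      refine ⟨color_swap_apply (c0.trans c1.symm), ?_⟩
      rw [← mul_swap_eq_swap_mul]
      exact (reach_claw_of_ne hx hy hz hxy hxz hyz c0 c1 c2' c3' (by rwa [c2, c3])).symm
    · have hβ := hbK _ _ c2' c3'
      refine ⟨_, hβ, fun w => ?_, ?_⟩
      · rw [Perm.mul_apply, (hK _ hβ).1, color_swap_apply (c0.trans c1.symm)]
      · rw [mul_assoc, ← mul_swap_eq_swap_mul, ← mul_assoc, ← mul_swap_eq_swap_mul]
        exact (reach_claw hx hy hz hxy hxz hyz c0 c1 c2' c3').symm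
  have h4 : ∀ w ∈ S, c (τ w) = A → τ w = σ p ∨ τ w = σ q := by
    intro w hw hwA
    have hwS := symm_apply_mem (S := (S : Set V)) hoff hw
    rcases eq_or_eq_of_card hσ hcard hp hq hwS hpA hqA (by simpa using hwA) hpq with h | h
    · left; rw [← h]; simp
    · right; rw [← h]; simp
  have hne' : τ o ≠ τ x := τ.injective.ne hox
  refine .of_reach r ?_
  rcases h4 o hoS c0 with h | h <;> rcases h4 x hxS c1 with h' | h'
  · exact absurd (h.trans h'.symm) hne'
  · rwa [h, h'] at key
  · rw [h, h'] at key; exact key.symm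
  · exact absurd (h.trans h'.symm) hne'

end Claw

/-! ### Ears, connected supersets and tails of cut-edges. -/

section Graph

variable {V : Type*} {X : SimpleGraph V}

theorem mem_of_reachable {G : SimpleGraph V} {D : Set V}
    (hD : ∀ x ∈ D, ∀ y, G.Adj x y → y ∈ D) {a b : V} (h : G.Reachable a b) (ha : a ∈ D) :
    b ∈ D := by
  obtain ⟨p⟩ := h
  induction p with
  | nil => exact ha
  | cons h _ ih => exact ih (hD _ ha _ h)

theorem exists_adj_notMem (hX : X.Preconnected) {S : Set V} {a b : V} (ha : a ∈ S) (hb : b ∉ S) :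
    ∃ v ∈ S, ∃ w ∉ S, X.Adj v w := by
  by_contra! h
  exact hb (mem_of_reachable (fun x hx y hxy => by_contra fun hy => h x hx y hy hxy) (hX a b) ha)

theorem subset_of_closed {S D : Set V} (hS : (X.induce S).Preconnected)
    (hD : ∀ x ∈ D, ∀ y ∈ S, X.Adj x y → y ∈ D) {a : V} (ha : a ∈ S) (haD : a ∈ D) : S ⊆ D := by
  intro b hb
  exact mem_of_reachable (D := {x : S | (x : V) ∈ D}) (fun x hx y hxy => hD x hx y y.2 hxy)
    (hS ⟨a, ha⟩ ⟨b, hb⟩) haD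

/-- The edges of `X` that do not lie inside `S`. -/
def outerGraph (X : SimpleGraph V) (S : Set V) : SimpleGraph V where
  Adj x y := X.Adj x y ∧ ¬ (x ∈ S ∧ y ∈ S)
  symm := ⟨fun _ _ h => ⟨h.1.symm, fun h' => h.2 h'.symm⟩⟩
  loopless := ⟨fun _ h => h.1.ne rfl⟩

theorem outerGraph_le (S : Set V) : outerGraph X S ≤ X := fun _ _ h => h.1

/-- If two vertices of `S` are connected outside of `S` then there is an ear of `S` with two
distinct end vertices. -/
theorem exists_ear {S : Set V} {a b : V} (ha : a ∈ S) (hb : b ∈ S) (hab : a ≠ b)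
    (h : (outerGraph X S).Reachable a b) :
    ∃ a' ∈ S, ∃ b' ∈ S, a' ≠ b' ∧ ∃ p : X.Walk b' a', p.IsPath ∧
      (∀ x ∈ p.support, x ∈ S → x = a' ∨ x = b') ∧ ∃ x ∈ p.support, x ∉ S := by
  classical
  obtain ⟨p⟩ := h
  induction hn : p.length using Nat.strong_induction_on generalizing a b with
  | _ n ih =>
    by_cases hint : ∀ x ∈ p.bypass.support, x ∈ S → x = b ∨ x = a
    · refine ⟨b, hb, a, ha, hab.symm, p.bypass.mapLe (outerGraph_le S),
        (p.bypass_isPath).mapLe (outerGraph_le S), by simpa using hint, ?_⟩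
      have hnil : ¬ p.bypass.Nil := p.bypass.not_nil_of_ne hab
      refine ⟨p.bypass.snd, by simp, fun hs => ?_⟩
      -- The first edge does not lie inside `S` but starts there, so the second vertex of the ear is
      -- new.
      exact (p.bypass.adj_snd hnil).2 ⟨ha, hs⟩
    · push Not at hint
      obtain ⟨x, hx, hxS, hxb, hxa⟩ := hint
      have hlt := SimpleGraph.Walk.length_takeUntil_lt_length hx hxb
      have hle := p.length_bypass_le_length
      exact ih _ (by omega) ha hxS hxa.symm (p.bypass.takeUntil x hx) rfl

/-- In a connected graph, every connected set of vertices is contained in connected sets of all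
larger sizes. -/
theorem exists_connected_superset [DecidableEq V] [Fintype V] (hX : X.Preconnected) {S : Finset V}
    (hS : (X.induce (S : Set V)).Preconnected) (hne : S.Nonempty) {k : ℕ} (hSk : S.card ≤ k)
    (hk : k ≤ Fintype.card V) :
    ∃ T : Finset V, S ⊆ T ∧ (X.induce (T : Set V)).Preconnected ∧ T.card = k := by
  induction k, hSk using Nat.le_induction with
  | base => exact ⟨S, subset_rfl, hS, rfl⟩
  | succ k hk' ih =>
    obtain ⟨T, hST, hT, hTk⟩ := ih (by omega)
    obtain ⟨a, ha⟩ := hne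
    obtain ⟨b, hb⟩ : ∃ b, b ∉ T := by
      by_contra! h
      rw [Finset.eq_univ_iff_forall.2 h, Finset.card_univ] at hTk
      omega
    obtain ⟨v, hv, w, hw, hvw⟩ := exists_adj_notMem hX (S := (T : Set V)) (hST ha) hb
    refine ⟨T ∪ hvw.toWalk.support.toFinset, hST.trans Finset.subset_union_left,
      preconnected_induce_union_support hT hv _, ?_⟩
    have e : T ∪ hvw.toWalk.support.toFinset = insert w T := by
      ext x
      simp only [SimpleGraph.Walk.support_cons, SimpleGraph.Walk.support_nil, Finset.mem_union,
        List.mem_toFinset, List.mem_cons, List.not_mem_nil, or_false, Finset.mem_insert]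
      constructor
      · rintro (h | rfl | rfl)
        exacts [Or.inr h, Or.inr hv, Or.inl rfl]
      · tauto
    rw [e, Finset.card_insert_of_notMem hw, hTk]

theorem exists_adj_mem_of_preconnected {S : Set V} (hS : (X.induce S).Preconnected) {u a b : V}
    (hu : u ∈ S) (ha : a ∈ S) (hb : b ∈ S) (hab : a ≠ b) : ∃ x ∈ S, X.Adj u x := by
  have : Nontrivial S := ⟨⟨a, ha⟩, ⟨b, hb⟩, fun h => hab (congrArg Subtype.val h)⟩
  obtain ⟨x, hx⟩ := hS.exists_adj_of_nontrivial ⟨u, hu⟩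
  exact ⟨x, x.2, hx⟩

theorem ncard_neighborSet_ne_one {v a b : V} (ha : X.Adj v a) (hb : X.Adj v b) (hab : a ≠ b) :
    (X.neighborSet v).ncard ≠ 1 := by
  intro h
  obtain ⟨w, hw⟩ := Set.ncard_eq_one.1 h
  have h1 : a ∈ X.neighborSet v := ha
  have h2 : b ∈ X.neighborSet v := hb
  rw [hw] at h1 h2
  exact hab (h1.trans h2.symm)

/-- The path `p` in `S` consists of cut-edges, and it is attached to the rest of `S` only at its
first vertex `u`. -/
structure IsTail {V : Type*} (X : SimpleGraph V) (S : Finset V) {u v : V} (p : X.Walk u v) :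
    Prop where
  isPath : p.IsPath
  mem : ∀ x ∈ p.support, x ∈ S
  isBridge : ∀ e ∈ p.edges, X.IsBridge e
  closed : ∀ x ∈ p.support, x ≠ u → ∀ y ∈ S, X.Adj x y → y ∈ p.support
  ncard : ∀ x ∈ p.support, x ≠ u → x ≠ v → (X.neighborSet x).ncard = 2
  unique : ∀ x ∈ p.support, ∀ y ∈ p.support, X.Adj u x → X.Adj u y → x = y
  exists_adj : u ≠ v → ∃ x ∈ p.support, X.Adj u x

theorem IsTail.nil {S : Finset V} {v : V} (hv : v ∈ S) :
    IsTail X S (SimpleGraph.Walk.nil : X.Walk v v) where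
  isPath := by simp
  mem := by simpa
  isBridge := by simp
  closed := by simp
  ncard := by simp
  unique := by simp
  exists_adj := by simp

/-- If `S` has no ears (`hear`) and `u` has no neighbour in `S` off the path except `t`, then all
connections between the tail and the rest of `S` pass through the edge `tu`, which is thus a
cut-edge. -/
theorem IsTail.cons {S : Finset V} {u v t : V} {p : X.Walk u v} (h : IsTail X S p)
    (hear : ∀ a ∈ S, ∀ b ∈ S, (outerGraph X S).Reachable a b → a = b) (ht : t ∈ S)
    (htp : t ∉ p.support) (htu : X.Adj t u)
    (htail : ∀ y ∈ S, y ∉ p.support → X.Adj u y → y = t)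
    (hout : u ≠ v → ∀ y, X.Adj u y → y ∈ S) : IsTail X S (SimpleGraph.Walk.cons htu p) := by
  have hadj : ∀ x ∈ p.support, X.Adj t x → x = u := by
    intro x hx htx
    by_contra hxu
    exact htp (h.closed x hx hxu t ht htx.symm)
  refine ⟨(SimpleGraph.Walk.cons_isPath_iff _ _).2 ⟨h.isPath, htp⟩, ?_, ?_, ?_, ?_, ?_, ?_⟩
  · simpa [ht] using h.mem
  · intro e he
    rw [SimpleGraph.Walk.edges_cons, List.mem_cons] at he
    rcases he with rfl | he
    · rw [SimpleGraph.isBridge_iff]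
      intro hr
      -- The path together with everything hanging on it outside `S` is closed under adjacency once
      -- the edge `tu` is deleted.
      have hD : ∀ x ∈ {x | ∃ s ∈ p.support, (outerGraph X S).Reachable x s}, ∀ y,
          (X.deleteEdges {s(t, u)}).Adj x y →
            y ∈ {x | ∃ s ∈ p.support, (outerGraph X S).Reachable x s} := by
        rintro x ⟨s, hs, hxs⟩ y hxy
        rw [SimpleGraph.deleteEdges_adj] at hxy
        by_cases hxyS : x ∈ S ∧ y ∈ S
        · obtain rfl := hear x hxyS.1 s (h.mem s hs) hxs
          suffices hy : y ∈ p.support from ⟨y, hy, SimpleGraph.Reachable.refl _⟩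
          by_cases hxu : x = u
          · subst hxu
            by_contra hy
            obtain rfl := htail y hxyS.2 hy hxy.1
            exact hxy.2 (by rw [Sym2.eq_swap]; simp)
          · exact h.closed x hs hxu y hxyS.2 hxy.1
        · have : (outerGraph X S).Adj x y := ⟨hxy.1, hxyS⟩
          exact ⟨s, hs, this.symm.reachable.trans hxs⟩
      obtain ⟨s, hs, hts⟩ := mem_of_reachable hD hr.symm
        ⟨u, p.start_mem_support, SimpleGraph.Reachable.refl _⟩
      exact htp (hear t ht s (h.mem s hs) hts ▸ hs)
    · exact h.isBridge e he
  · intro x hx hxt y hy hxy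
    rw [SimpleGraph.Walk.support_cons, List.mem_cons] at hx ⊢
    have hx := hx.resolve_left hxt
    by_cases hxu : x = u
    · subst hxu
      by_contra! hy'
      exact hy'.1 (htail y hy hy'.2 hxy)
    · exact Or.inr (h.closed x hx hxu y hy hxy)
  · intro x hx hxt hxv
    rw [SimpleGraph.Walk.support_cons, List.mem_cons] at hx
    have hx := hx.resolve_left hxt
    by_cases hxu : x = u
    · subst hxu
      obtain ⟨s, hs, hxs⟩ := h.exists_adj hxv
      have e : X.neighborSet x = {s, t} := by
        ext y
        simp only [SimpleGraph.mem_neighborSet, Set.mem_insert_iff, Set.mem_singleton_iff]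
        constructor
        · intro hxy
          by_cases hy : y ∈ p.support
          · exact Or.inl (h.unique y hy s hs hxy hxs)
          · exact Or.inr (htail y (hout hxv y hxy) hy hxy)
        · rintro (rfl | rfl)
          exacts [hxs, htu.symm]
      rw [e, Set.ncard_pair]
      rintro rfl
      exact htp hs
    · exact h.ncard x hx hxu hxv
  · intro x hx y hy htx hty
    rw [SimpleGraph.Walk.support_cons, List.mem_cons] at hx hy
    have hx := hx.resolve_left htx.ne'
    have hy := hy.resolve_left hty.ne'
    rw [hadj x hx htx, hadj y hy hty]
  · intro _
    exact ⟨u, by simp, htu⟩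

end Graph

/-! ### Growing a good set to the whole graph. -/

section Grow

variable {V ι : Type*} [DecidableEq V] [Fintype V] {X : SimpleGraph V} {c : V → ι} {A : ι}
  {K : Subgroup (Perm V)} {S : Finset V} {o x y z : V} {m : ℕ}

/-- A good set that contains a claw can be enlarged if there are no long bridges. -/
theorem IsGood.exists_ssuperset (hX : X.Preconnected) (hK : FixesColor c A K)
    (hgood : IsGood X c A K S) (hS : (X.induce (S : Set V)).Preconnected)
    (hcard : Nat.card {x // c x ≠ A} + 2 ≤ S.card) (hm : 2 ≤ m)
    (hmA : m ≤ Nat.card {x // c x ≠ A}) (hbr : ¬ X.ContainsKBridge m)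
    (hx : X.Adj o x) (hy : X.Adj o y) (hz : X.Adj o z) (hxy : x ≠ y) (hxz : x ≠ z)
    (hyz : y ≠ z) (hoS : o ∈ S) (hxS : x ∈ S) (hyS : y ∈ S) (hzS : z ∈ S) (hne : S ≠ Finset.univ) :
    ∃ T, S ⊂ T ∧ IsGood X c A K T ∧ (X.induce (T : Set V)).Preconnected := by
  by_contra! hno
  have hear : ∀ a ∈ S, ∀ b ∈ S, (outerGraph X S).Reachable a b → a = b := by
    intro a ha b hb hr
    by_contra hab
    obtain ⟨a', ha', b', hb', hab', p, hp, hint, w, hw, hwS⟩ :=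
      exists_ear (S := (S : Set V)) ha hb hab hr
    refine hno _ ?_ (hgood.union_ear hK hS hcard (by omega) p hp hab' ha' hb' hint)
      (preconnected_induce_union_support hS hb' p)
    exact Finset.ssubset_iff_of_subset Finset.subset_union_left |>.2 ⟨w, by simp [hw], hwS⟩
  -- Since no vertex can be added, the start of a short path in `S` to a vertex with an outside
  -- neighbour is not a branch vertex.
  have hpend : ∀ {u v w : V} (p : X.Walk u v), p.IsPath → (∀ x ∈ p.support, x ∈ S) → w ∉ S →
      X.Adj v w → p.length + 2 ≤ m → ∀ u₁ ∈ S, ∀ u₂ ∈ S, u₁ ∉ p.support → u₂ ∉ p.support →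
      X.Adj u u₁ → X.Adj u u₂ → u₁ = u₂ := by
    intro u v w p hp hpS hw hvw hlen u₁ hu₁ u₂ hu₂ hp₁ hp₂ h₁ h₂
    by_contra h₁₂
    have hq : (p.concat hvw).IsPath := hp.concat (fun h => hw (hpS _ h)) hvw
    have hsup : ∀ x, x ∈ (p.concat hvw).support ↔ x ∈ p.support ∨ x = w := by
      simp [SimpleGraph.Walk.support_concat]
    have huS := hpS u p.start_mem_support
    refine hno _ ?_ (hgood.union_pendant hK hS hcard (p.concat hvw) hq hw ?_ h₁ h₂ h₁₂ ?_ ?_ hu₁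
      hu₂ ?_ ?_) (preconnected_induce_union_support hS huS _)
    · exact Finset.ssubset_iff_of_subset Finset.subset_union_left |>.2 ⟨w, by simp, hw⟩
    · intro t ht htw
      exact hpS t (((hsup t).1 ht).resolve_right htw)
    · rw [hsup]
      rintro (h | rfl)
      exacts [hp₁ h, hw hu₁]
    · rw [hsup]
      rintro (h | rfl)
      exacts [hp₂ h, hw hu₂]
    · rintro rfl
      exact hw huS
    · rw [SimpleGraph.Walk.length_concat]
      omega
  obtain ⟨b, hb⟩ : ∃ b, b ∉ S := by
    by_contra! h
    exact hne (Finset.eq_univ_iff_forall.2 h)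
  obtain ⟨v, hv, w, hw, hvw⟩ := exists_adj_notMem hX (S := (S : Set V)) hoS hb
  replace hv : v ∈ S := hv
  replace hw : w ∉ S := hw
  have hout : ∀ u ∈ S, ∀ s ∈ S, ∀ t ∈ S, X.Adj u s → X.Adj u t → s ≠ t → ∀ y, X.Adj u y →
      y ∈ S := by
    intro u hu s hs t ht hus hut hst y huy
    by_contra hyS
    exact hst (hpend (SimpleGraph.Walk.nil : X.Walk u u) (by simp) (by simpa) hyS huy (by simpa)
      s hs t ht (by simpa using hus.ne') (by simpa using hut.ne') hus hut)
  -- A tail that cannot be continued would fill `S`, including the claw; but no vertex of a tail can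
  -- have the three neighbours of the claw's centre.
  have hnext : ∀ {u : V} (p : X.Walk u v), IsTail X S p → ∃ t ∈ S, t ∉ p.support ∧ X.Adj u t := by
    intro u p hp
    by_contra! h
    have hsub : (S : Set V) ⊆ {x | x ∈ p.support} := by
      refine subset_of_closed hS ?_ (hp.mem u p.start_mem_support) p.start_mem_support
      intro s hs t ht hst
      by_cases hsu : s = u
      · subst hsu
        by_contra htp
        exact h t ht htp hst
      · exact hp.closed s hs hsu t ht hst
    have ho : o ∈ p.support := hsub hoS
    by_cases hou : o = u
    · subst hou
      exact hxy (hp.unique x (hsub hxS) y (hsub hyS) hx hy)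
    by_cases hov : o = v
    · subst hov
      exact hw (hout o hoS x hxS y hyS hx hy hxy w hvw)
    have h2 := hp.ncard o ho hou hov
    have h3 : ({x, y, z} : Set V) ⊆ X.neighborSet o := by
      rintro s (rfl | rfl | rfl) <;> assumption
    have h4 := Set.ncard_le_ncard h3
    rw [Set.ncard_eq_three.2 ⟨x, y, z, hxy, hxz, hyz, rfl⟩] at h4
    omega
  have hloop : ∀ j ≤ m - 1, ∃ (u : V) (p : X.Walk u v), IsTail X S p ∧ p.length = j := by
    intro j
    induction j with
    | zero => exact fun _ => ⟨v, _, IsTail.nil hv, rfl⟩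
    | succ j ih =>
      intro hj
      obtain ⟨u, p, hp, hpj⟩ := ih (by omega)
      obtain ⟨t, ht, htp, hut⟩ := hnext p hp
      refine ⟨t, _, hp.cons hear ht htp hut.symm ?_ ?_, by simp [hpj]⟩
      · intro s hs hsp hus
        exact hpend p hp.isPath hp.mem hw hvw (by omega) s hs t ht hsp htp hus hut
      · intro huv
        obtain ⟨s, hs, hus⟩ := hp.exists_adj huv
        exact hout u (hp.mem u p.start_mem_support) s (hp.mem s hs) t ht hus hut
          (by rintro rfl; exact htp hs)
  obtain ⟨u, p, hp, hpl⟩ := hloop (m - 1) le_rfl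
  obtain ⟨t, ht, htp, hut⟩ := hnext p hp
  have huv : u ≠ v := by
    intro huv
    have := hp.isPath.nil_iff_eq.2 huv
    rw [← SimpleGraph.Walk.length_eq_zero_iff] at this
    omega
  obtain ⟨s, hs, hus⟩ := hp.exists_adj huv
  obtain ⟨r, hr, hvr⟩ := exists_adj_mem_of_preconnected hS hv hoS hxS hx.ne
  -- A tail of length `m - 1` is an `m`-bridge: `u` has neighbours on and off the path, and `v` has
  -- neighbours inside and outside `S`.
  refine hbr (Or.inr ⟨hm, u, v, p, hp.isPath, by omega, hp.isBridge, hp.ncard,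
    ncard_neighborSet_ne_one hus hut ?_, ncard_neighborSet_ne_one hvr hvw ?_⟩)
  · rintro rfl; exact htp hs
  · rintro rfl; exact hw hr

/-- In a connected graph with a claw and without long bridges, all tokens of colour `A` are
swappable. -/
theorem swappable_of_claw (hX : X.Preconnected) (hK : FixesColor c A K)
    (hB : (∃ b₁ b₂, c b₁ ≠ A ∧ c b₂ ≠ A ∧ c b₁ ≠ c b₂) ∨
      ∀ b₁ b₂, c b₁ ≠ A → c b₂ ≠ A → swap b₁ b₂ ∈ K) (hm : 2 ≤ m)
    (hmA : m ≤ Nat.card {x // c x ≠ A})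
    (hbr : ¬ X.ContainsKBridge m ∨ Fintype.card V ≤ Nat.card {x // c x ≠ A} + 2)
    (hx : X.Adj o x) (hy : X.Adj o y) (hz : X.Adj o z) (hxy : x ≠ y) (hxz : x ≠ z)
    (hyz : y ≠ z) (σ : Perm V) {p q : V} (hp : c p = A) (hq : c q = A) :
    Swappable X c K σ p q := by
  classical
  rcases eq_or_ne p q with rfl | hpq
  · exact Swappable.refl _ _
  suffices hgood : IsGood X c A K Finset.univ by
    simpa using hgood σ (by simp) (σ.symm p) (by simp) (σ.symm q) (by simp) (by simpa)
      (by simpa)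
  have hcardV : Nat.card {x // c x ≠ A} + 2 ≤ Fintype.card V := by
    have h1 : ({p, q} : Finset V) ⊆ Finset.univ.filter fun x => c x = A := by
      intro w hw
      simp only [Finset.mem_insert, Finset.mem_singleton] at hw
      rcases hw with rfl | rfl <;> simp [*]
    have h2 := Finset.card_le_card h1
    rw [Finset.card_pair hpq] at h2
    have h3 := Finset.card_filter_add_card_filter_not (s := Finset.univ) (fun x => c x = A)
    rw [Nat.card_eq_fintype_card, Fintype.card_subtype]
    rw [Finset.card_univ] at h3
    simp only [ne_eq]
    omega
  have hox := hx.ne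
  have hoy := hy.ne
  have hoz := hz.ne
  have hC : (X.induce (({o, x, y, z} : Finset V) : Set V)).Preconnected := by
    have h : ∀ w : (({o, x, y, z} : Finset V) : Set V),
        (X.induce (({o, x, y, z} : Finset V) : Set V)).Reachable ⟨o, by simp⟩ w := by
      rintro ⟨w, hw⟩
      have hw' : w = o ∨ w = x ∨ w = y ∨ w = z := by simpa using hw
      rcases hw' with rfl | rfl | rfl | rfl
      · exact SimpleGraph.Reachable.refl _
      all_goals exact SimpleGraph.Adj.reachable (by simpa)
    exact fun v w => (h v).symm.trans (h w)
  have hC4 : ({o, x, y, z} : Finset V).card = 4 := by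
    rw [Finset.card_insert_of_notMem (by simp [*]), Finset.card_eq_three.2
      ⟨x, y, z, hxy, hxz, hyz, rfl⟩]
  -- The size leaves room for exactly two `A` tokens; it is at least `4`, so the claw fits.
  obtain ⟨T, hT, hTc, hTk⟩ := exists_connected_superset hX hC (by simp)
    (k := Nat.card {x // c x ≠ A} + 2) (by omega) hcardV
  have hTo : o ∈ T := hT (by simp)
  have hTx : x ∈ T := hT (by simp)
  have hTy : y ∈ T := hT (by simp)
  have hTz : z ∈ T := hT (by simp)
  have hTgood := isGood_of_claw hK hB (by omega) hTc hTk hx hy hz hxy hxz hyz hTo hTx hTy hTz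
  obtain ⟨U, hTU, hU⟩ := (Set.toFinite {U : Finset V | T ⊆ U ∧ IsGood X c A K U ∧
    (X.induce (U : Set V)).Preconnected}).exists_le_maximal ⟨subset_rfl, hTgood, hTc⟩
  obtain ⟨⟨-, hUgood, hUc⟩, hmax⟩ := hU
  by_cases hUV : U = Finset.univ
  · rwa [← hUV]
  exfalso
  have hTU' := Finset.card_le_card hTU
  rcases hbr with hbr | hbr
  · obtain ⟨W, hUW, hW, hWc⟩ := hUgood.exists_ssuperset hX hK hUc (by omega) hm hmA hbr hx hy hz
      hxy hxz hyz (hTU hTo) (hTU hTx) (hTU hTy) (hTU hTz) hUV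
    exact hUW.2 (hmax ⟨hTU.trans hUW.1, hW, hWc⟩ hUW.1)
  · exact hUV (Finset.eq_univ_of_card _ (le_antisymm (Finset.card_le_univ U) (by omega)))

end Grow

/-! ### Existence of claws and of non-spanning odd cycles. -/

section Cycles

variable {V : Type*} {X : SimpleGraph V}

theorem succ_mod_eq {L i : ℕ} (hi : i < L) : (i + 1) % L = if i + 1 = L then 0 else i + 1 := by
  split_ifs with h
  · rw [h, Nat.mod_self]
  · exact Nat.mod_eq_of_lt (by omega)

theorem cycleGraph_adj_iff {L : ℕ} (hL : 3 ≤ L) (i j : Fin L) :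
    (SimpleGraph.cycleGraph L).Adj i j ↔ (j : ℕ) = (i + 1) % L ∨ (i : ℕ) = (j + 1) % L := by
  have key : ∀ i j : Fin L, (i - j).val = 1 ↔ (i : ℕ) = (j + 1) % L := by
    intro i j
    have hi := i.2
    have hj := j.2
    rw [succ_mod_eq hj]
    rcases le_or_gt j i with h | h
    · rw [Fin.sub_val_of_le h]
      have : (j : ℕ) ≤ i := h
      split_ifs <;> omega
    · rw [Fin.coe_sub_iff_lt.2 h]
      have : (i : ℕ) < j := h
      split_ifs <;> omega
  rw [SimpleGraph.cycleGraph_adj', key, key, or_comm]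

theorem isCycleGraph_of_enumeration {L : ℕ} (hL : 3 ≤ L) {g : ℕ → V}
    (hinj : ∀ i < L, ∀ j < L, g i = g j → i = j) (hsurj : ∀ v, ∃ i < L, g i = v)
    (hadj : ∀ i < L, X.Adj (g i) (g ((i + 1) % L)))
    (hadj' : ∀ i < L, ∀ j < L, X.Adj (g i) (g j) → j = (i + 1) % L ∨ i = (j + 1) % L) :
    X.IsCycleGraph := by
  refine ⟨L, hL, ⟨SimpleGraph.Iso.symm ⟨Equiv.ofBijective (fun i : Fin L => g i) ⟨?_, ?_⟩, ?_⟩⟩⟩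
  · intro i j h
    exact Fin.ext (hinj i i.2 j j.2 h)
  · intro v
    obtain ⟨i, hi, h⟩ := hsurj v
    exact ⟨⟨i, hi⟩, h⟩
  · intro i j
    rw [cycleGraph_adj_iff hL]
    change X.Adj (g i) (g j) ↔ _
    constructor
    · exact hadj' i i.2 j j.2
    · rintro (h | h)
      · rw [h]; exact hadj i i.2
      · rw [h]; exact (hadj j j.2).symm

theorem adj_getVert_mod {u : V} (p : X.Walk u u) {i : ℕ} (hi : i < p.length) :
    X.Adj (p.getVert i) (p.getVert ((i + 1) % p.length)) := by
  have h := p.adj_getVert_succ hi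
  rw [succ_mod_eq hi]
  split_ifs with h'
  · rw [h', p.getVert_length] at h
    rwa [p.getVert_zero]
  · exact h

/-- A connected graph that is neither a tree nor a cycle contains a claw. -/
theorem exists_claw (hX : X.Connected) (hcyc : ¬ X.IsCycleGraph) (htree : ¬ X.IsTree) :
    ∃ o x y z, X.Adj o x ∧ X.Adj o y ∧ X.Adj o z ∧ x ≠ y ∧ x ≠ z ∧ y ≠ z := by
  by_contra! hno
  have hac : ¬ X.IsAcyclic := fun h => htree ⟨hX, h⟩
  simp only [SimpleGraph.IsAcyclic, not_forall, not_not] at hac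
  obtain ⟨u, p, hp⟩ := hac
  have hL := hp.three_le_length
  have hinj : ∀ i < p.length, ∀ j < p.length, p.getVert i = p.getVert j → i = j := by
    intro i hi j hj h
    exact hp.getVert_injOn' (show i ≤ p.length - 1 by omega) (show j ≤ p.length - 1 by omega) h
  -- A neighbour other than the two on the cycle would create a claw. Hence the cycle has no chords
  -- and, by connectedness, is the whole graph.
  have hnbr : ∀ i < p.length, ∀ w, X.Adj (p.getVert i) w →
      ∃ j < p.length, w = p.getVert j ∧ (j = (i + 1) % p.length ∨ i = (j + 1) % p.length) := by
    intro i hi w hw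
    obtain ⟨k, hk, hki, hne⟩ : ∃ k < p.length, (k + 1) % p.length = i ∧
        k ≠ (i + 1) % p.length := by
      rcases Nat.eq_zero_or_pos i with rfl | h0
      · refine ⟨p.length - 1, by omega, ?_, ?_⟩
        · rw [succ_mod_eq (by omega), if_pos (by omega)]
        · rw [succ_mod_eq hi]; split_ifs <;> omega
      · refine ⟨i - 1, by omega, ?_, ?_⟩
        · rw [succ_mod_eq (by omega), if_neg (by omega)]; omega
        · rw [succ_mod_eq hi]; split_ifs <;> omega
    have h1 := adj_getVert_mod p hi
    have h2 := adj_getVert_mod p hk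
    rw [hki] at h2
    have hlt : (i + 1) % p.length < p.length := Nat.mod_lt _ (by omega)
    by_cases hwi : w = p.getVert ((i + 1) % p.length)
    · exact ⟨_, hlt, hwi, Or.inl rfl⟩
    · refine ⟨k, hk, ?_, Or.inr hki.symm⟩
      exact hno _ _ _ _ h1 hw h2.symm (Ne.symm hwi) fun h => hne (hinj _ hk _ hlt h.symm)
  refine hcyc (isCycleGraph_of_enumeration hL hinj ?_ (fun i hi => adj_getVert_mod p hi) ?_)
  · intro v
    refine mem_of_reachable (D := {v | ∃ i < p.length, p.getVert i = v}) ?_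
      (hX.preconnected u v) ⟨0, by omega, p.getVert_zero⟩
    rintro x ⟨i, hi, rfl⟩ y hxy
    obtain ⟨j, hj, rfl, -⟩ := hnbr i hi y hxy
    exact ⟨j, hj, rfl⟩
  · intro i hi j hj hij
    obtain ⟨j', hj', h, h'⟩ := hnbr i hi _ hij
    rwa [← hinj j hj j' hj' h] at h'

theorem exists_walk_getVert {u v : V} (p : X.Walk u v) {i j : ℕ} (hij : i ≤ j)
    (hj : j ≤ p.length) : ∃ q : X.Walk (p.getVert i) (p.getVert j), q.length = j - i := by
  induction j, hij using Nat.le_induction with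
  | base => exact ⟨.nil, by simp⟩
  | succ j hij ih =>
    obtain ⟨q, hq⟩ := ih (by omega)
    exact ⟨q.concat (p.adj_getVert_succ (by omega)), by
      rw [SimpleGraph.Walk.length_concat, hq]; omega⟩

/-- A non-bipartite graph that is not a cycle has a non-spanning odd cycle. The cycle is given as
a list whose rotations are chains for the adjacency relation. -/
theorem exists_odd_cycle [Fintype V] (hX : ¬ X.IsBipartite) (hcyc : ¬ X.IsCycleGraph) :
    ∃ l : List V, l.Nodup ∧ Odd l.length ∧ 3 ≤ l.length ∧ l.length < Fintype.card V ∧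
      ∀ n, (l.rotate n).IsChain X.Adj := by
  classical
  have hex : ∃ n, Odd n ∧ ∃ (u : V) (p : X.Walk u u), p.length = n := by
    rw [SimpleGraph.IsBipartite, SimpleGraph.two_colorable_iff_forall_loop_even] at hX
    push Not at hX
    obtain ⟨u, p, hp⟩ := hX
    exact ⟨_, Nat.not_even_iff_odd.1 hp, u, p, rfl⟩
  obtain ⟨hodd, u, p, hpl⟩ := Nat.find_spec hex
  have hmin : ∀ (v : V) (q : X.Walk v v), Odd q.length → p.length ≤ q.length := by
    intro v q hq
    rw [hpl]
    exact Nat.find_min' hex ⟨hq, v, q, rfl⟩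
  rw [← hpl] at hodd
  have hL : 3 ≤ p.length := by
    by_contra! h
    have h1 : p.length = 1 := by
      obtain ⟨k, hk⟩ := hodd
      omega
    have := p.adj_getVert_succ (i := 0) (by omega)
    rw [p.getVert_zero, p.getVert_of_length_le (by omega)] at this
    exact this.ne rfl
  -- As the closed walk `p` is odd, its two arcs between these vertices have different parities. One
  -- of them closes up with `q` to an odd closed walk, which is no shorter than `p`.
  have hchord : ∀ i j, i < j → j < p.length → ∀ q : X.Walk (p.getVert i) (p.getVert j),
      p.length ≤ j - i + q.length ∨ j - i ≤ q.length := by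
    intro i j hij hj q
    obtain ⟨r, hr⟩ := exists_walk_getVert p hij.le hj.le
    obtain ⟨s, hs⟩ : ∃ s : X.Walk (p.getVert j) (p.getVert i), s.length = p.length - j + i := by
      obtain ⟨r₁, hr₁⟩ : ∃ q : X.Walk u (p.getVert i), q.length = i := by
        have := exists_walk_getVert p (Nat.zero_le i) (by omega)
        rwa [p.getVert_zero] at this
      obtain ⟨r₂, hr₂⟩ : ∃ q : X.Walk (p.getVert j) u, q.length = p.length - j := by
        have := exists_walk_getVert p hj.le le_rfl
        rwa [p.getVert_length] at this
      exact ⟨r₂.append r₁, by rw [SimpleGraph.Walk.length_append, hr₁, hr₂]⟩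
    have h1 := hmin _ (r.append q.reverse)
    have h2 := hmin _ (q.append s)
    rw [SimpleGraph.Walk.length_append, SimpleGraph.Walk.length_reverse, hr] at h1
    rw [SimpleGraph.Walk.length_append, hs] at h2
    rcases Nat.even_or_odd (j - i + q.length) with he | ho
    · right
      have : Odd (q.length + (p.length - j + i)) := by
        obtain ⟨a, ha⟩ := he
        obtain ⟨b, hb⟩ := hodd
        exact ⟨b + q.length - a, by omega⟩
      have := h2 this
      omega
    · exact Or.inl (h1 ho)
  -- A repeated vertex is the case of a walk of length `0`; below, a chord is the case of length
  -- `1`.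
  have hne : ∀ i j, i < j → j < p.length → p.getVert i ≠ p.getVert j := by
    intro i j hij hj h
    have := hchord i j hij hj (SimpleGraph.Walk.nil.copy rfl h)
    rw [SimpleGraph.Walk.length_copy, SimpleGraph.Walk.length_nil] at this
    omega
  have hinj : ∀ i < p.length, ∀ j < p.length, p.getVert i = p.getVert j → i = j := by
    intro i hi j hj h
    rcases lt_trichotomy i j with hij | hij | hij
    · exact absurd h (hne i j hij hj)
    · exact hij
    · exact absurd h.symm (hne j i hij hi)
  have hadj : ∀ i j, i < j → j < p.length → X.Adj (p.getVert i) (p.getVert j) →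
      j = (i + 1) % p.length ∨ i = (j + 1) % p.length := by
    intro i j hij hj h
    have := hchord i j hij hj h.toWalk
    rw [SimpleGraph.Walk.length_cons, SimpleGraph.Walk.length_nil] at this
    rw [succ_mod_eq (by omega), succ_mod_eq (by omega)]
    split_ifs <;> omega
  have hns : ∃ v, ∀ i < p.length, p.getVert i ≠ v := by
    by_contra! hsurj
    refine hcyc (isCycleGraph_of_enumeration hL hinj hsurj
      (fun i hi => adj_getVert_mod p hi) fun i hi j hj hij => ?_)
    rcases lt_trichotomy i j with h | h | h
    · exact hadj i j h hj hij
    · exact absurd (congrArg p.getVert h) hij.ne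
    · exact (hadj j i h hi hij.symm).symm
  have hnd : ((List.range p.length).map p.getVert).Nodup := by
    refine List.Nodup.map_on (fun i hi j hj h => ?_) List.nodup_range
    exact hinj i (by simpa using hi) j (by simpa using hj) h
  refine ⟨(List.range p.length).map p.getVert, hnd, by simpa, by simpa, ?_, fun n => ?_⟩
  · obtain ⟨v, hv⟩ := hns
    rw [← List.toFinset_card_of_nodup hnd, ← Finset.card_univ]
    refine Finset.card_lt_card (Finset.ssubset_univ_iff.2 fun h => ?_)
    have := Finset.mem_univ v
    rw [← h] at this
    simp only [List.mem_toFinset, List.mem_map, List.mem_range] at this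
    obtain ⟨i, hi, hiv⟩ := this
    exact hv i hi hiv
  · rw [List.isChain_iff_getElem]
    intro i hi
    simp only [List.getElem_rotate, List.getElem_map, List.getElem_range, List.length_map,
      List.length_range]
    have h := adj_getVert_mod p (Nat.mod_lt (i + n) (show 0 < p.length by omega))
    rwa [Nat.mod_add_mod, show i + n + 1 = i + 1 + n by omega] at h

end Cycles

/-! ### Normal subgroups containing an odd permutation. -/

section NormalOdd

variable {α : Type*} [DecidableEq α] [Fintype α]

theorem eq_top_of_alternatingGroup_le {N : Subgroup (Perm α)} (h : alternatingGroup α ≤ N)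
    {g : Perm α} (hg : g ∈ N) (hs : Perm.sign g = -1) : N = ⊤ := by
  rw [eq_top_iff]
  intro f _
  rcases Int.units_eq_one_or (Perm.sign f) with h1 | h1
  · exact h (Perm.mem_alternatingGroup.2 h1)
  · have : f * g⁻¹ ∈ N := h (Perm.mem_alternatingGroup.2 (by simp [hs, h1]))
    simpa using N.mul_mem this hg

/-- A normal subgroup of a symmetric group that contains an odd permutation is everything. -/
theorem normal_eq_top_of_odd (N : Subgroup (Perm α)) [hN : N.Normal] {g : Perm α} (hg : g ∈ N)
    (hs : Perm.sign g = -1) : N = ⊤ := by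
  by_cases h2 : ∃ x, g (g x) ≠ x
  · obtain ⟨x, hx⟩ := h2
    have hx1 : g x ≠ x := fun h => hx (by rw [h, h])
    have hx2 : g (g x) ≠ g x := fun h => hx1 (g.injective h)
    -- If `g` is not an involution, this commutator is a 3-cycle, and its conjugates generate the
    -- alternating group.
    have hmem : swap x (g x) * g * (swap x (g x))⁻¹ * g⁻¹ ∈ N :=
      N.mul_mem (hN.conj_mem g hg _) (N.inv_mem hg)
    have e : swap x (g x) * g * (swap x (g x))⁻¹ * g⁻¹ =
        swap (g x) x * swap (g x) (g (g x)) := by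
      rw [mul_assoc (swap x (g x)) g, swap_inv, mul_swap_eq_swap_mul, swap_comm x (g x)]
      simp [mul_assoc]
    rw [e] at hmem
    have h3 := Perm.isThreeCycle_swap_mul_swap_same hx1 hx2.symm hx.symm
    refine eq_top_of_alternatingGroup_le ?_ hg hs
    rw [← Perm.closure_three_cycles_eq_alternating, Subgroup.closure_le]
    intro f hf
    have hf' : f.IsThreeCycle := hf
    obtain ⟨k, hk⟩ := isConj_iff.1
      (Perm.isConj_iff_cycleType_eq.2 (h3.cycleType.trans hf'.cycleType.symm))
    rw [← hk]
    exact hN.conj_mem _ hmem k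
  · push Not at h2
    have hg1 : g ≠ 1 := by
      rintro rfl
      simp at hs
    by_cases h5 : 5 ≤ Nat.card α
    · exact eq_top_of_alternatingGroup_le (Perm.alternatingGroup_le_of_normal h5
        ⟨⟨⟨g, hg⟩, 1, fun h => hg1 (congrArg Subtype.val h)⟩⟩) hg hs
    obtain ⟨x, hx⟩ : ∃ x, g x ≠ x := by
      by_contra! h
      exact hg1 (Perm.ext h)
    -- On at most four points an involution that is not a transposition is a double transposition,
    -- which is even.
    have hgx : g = swap x (g x) := by
      by_contra hne
      obtain ⟨z, hz⟩ : ∃ z, g z ≠ swap x (g x) z := by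
        by_contra! h
        exact hne (Perm.ext h)
      have hzx : z ≠ x := by rintro rfl; simp at hz
      have hzy : z ≠ g x := by rintro rfl; simp [h2] at hz
      rw [swap_apply_of_ne_of_ne hzx hzy] at hz
      have hd : ({x, g x, z, g z} : Finset α).card = 4 := by
        have h1 : g z ≠ x := fun h => hzy (by rw [← h, h2])
        have h3 : g z ≠ g x := g.injective.ne hzx
        rw [Finset.card_insert_of_notMem (by simp [hx.symm, hzx.symm, h1.symm]),
          Finset.card_eq_three.2 ⟨g x, z, g z, hzy.symm, h3.symm, hz.symm, rfl⟩]
      have huniv : ({x, g x, z, g z} : Finset α) = Finset.univ := by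
        refine Finset.eq_univ_of_card _ (le_antisymm (Finset.card_le_univ _) ?_)
        rw [hd, ← Nat.card_eq_fintype_card]
        omega
      have e : g = swap x (g x) * swap z (g z) := by
        have h1 : g z ≠ x := fun h => hzy (by rw [← h, h2])
        have h3 : g z ≠ g x := g.injective.ne hzx
        ext w
        have hw : w = x ∨ w = g x ∨ w = z ∨ w = g z := by
          have := Finset.mem_univ w
          rw [← huniv] at this
          simpa using this
        rcases hw with rfl | rfl | rfl | rfl
        · rw [Perm.mul_apply, swap_apply_of_ne_of_ne hzx.symm h1.symm, swap_apply_left]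
        · rw [Perm.mul_apply, swap_apply_of_ne_of_ne hzy.symm h3.symm, swap_apply_right, h2]
        · rw [Perm.mul_apply, swap_apply_left, swap_apply_of_ne_of_ne h1 h3]
        · rw [Perm.mul_apply, swap_apply_right, swap_apply_of_ne_of_ne hzx hzy, h2]
      rw [e, Perm.sign_mul, Perm.sign_swap hx.symm, Perm.sign_swap hz.symm] at hs
      exact absurd hs (by decide)
    rw [eq_top_iff, ← Perm.closure_isSwap, Subgroup.closure_le]
    rintro f ⟨a, b, hab, rfl⟩
    obtain ⟨k, hk⟩ := isConj_iff.1 (Perm.isConj_swap hx.symm hab)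
    rw [← hk, ← hgx]
    exact hN.conj_mem g hg k

end NormalOdd

theorem color_apply_of_fixes {V ι : Type*} {c : V → ι} {A : ι} {α : Perm V}
    (hα : ∀ y, c y ≠ A → α y = y) (y : V) : c (α y) = c y := by
  by_cases hy : c y = A
  · by_contra h
    exact h (congrArg c (α.injective (hα (α y) (hy ▸ h))))
  · rw [hα y hy]

theorem countP_comp_perm {V : Type*} {l : List V} (hd : l.Nodup) {π : Perm V}
    (hπ : ∀ x ∈ l, π x ∈ l)
    (P : V → Prop) [DecidablePred P] :
    (l.countP fun x => P (π x)) = l.countP fun x => P x := by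
  have hp : (l.map π).Perm l := by
    refine (List.Nodup.subperm (hd.map π.injective) ?_).perm_of_length_le (by simp)
    intro x hx
    obtain ⟨y, hy, rfl⟩ := List.mem_map.1 hx
    exact hπ y hy
  have := hp.countP_eq fun x => decide (P x)
  rwa [List.countP_map] at this

/-! ### Odd permutations from odd cycles. -/

section OddCycle

variable {V ι : Type*} [DecidableEq V] [DecidableEq ι] {X : SimpleGraph V} {c : V → ι} {A : ι}
  {σ : Perm V}

/-- Moving a token of colour `A` along a path, where it overtakes other tokens of this colour only
virtually, shifts the path up to a permutation of the tokens of colour `A` of known sign. -/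
theorem exists_reach_mul_formPerm [Fintype V] {x : V} {l : List V} (hl : (x :: l).IsChain X.Adj)
    (hd : (x :: l).Nodup) (hx : c (σ x) = A) :
    ∃ α : Perm V, (∀ y, c y ≠ A → α y = y) ∧
      Perm.sign α = (-1) ^ (l.countP fun z => c (σ z) = A) ∧
      Reach X c (α * σ * (x :: l).formPerm) σ := by
  induction l generalizing x σ with
  | nil => exact ⟨1, by simp, by simp, by simpa using Reach.refl σ⟩
  | cons y l ih =>
    rw [List.isChain_cons_cons] at hl
    rw [List.nodup_cons] at hd
    obtain ⟨α, h1, h2, h3⟩ := ih (σ := σ * swap x y) hl.2 hd.2 (by simpa)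
    have hcount : (l.countP fun z => c ((σ * swap x y) z) = A) =
        l.countP fun z => c (σ z) = A := by
      refine List.countP_congr fun z hz => ?_
      have hzx : z ≠ x := fun e => hd.1 (by simp [← e, hz])
      have hzy : z ≠ y := fun e => (List.nodup_cons.1 hd.2).1 (by simp [← e, hz])
      simp [swap_apply_of_ne_of_ne hzx hzy]
    rw [hcount] at h2
    rw [List.formPerm_cons_cons, List.countP_cons]
    -- Overtaking a like token is no move; it is recorded as a transposition of labels, which
    -- contributes one sign.
    by_cases hy : c (σ y) = A
    · have hxy : σ x ≠ σ y := σ.injective.ne hl.1.ne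
      refine ⟨swap (σ x) (σ y) * α, fun z hz => ?_, ?_, ?_⟩
      · rw [Perm.mul_apply, h1 z hz, swap_apply_of_ne_of_ne] <;> rintro rfl <;> contradiction
      · rw [Perm.sign_mul, Perm.sign_swap hxy, h2]
        simp [hy, pow_succ]
      · have := h3.mul_left (g := swap (σ x) (σ y)) (color_swap_apply (hx.trans hy.symm))
        have e : swap (σ x) (σ y) * (σ * swap x y) = σ := by
          rw [mul_swap_eq_swap_mul, ← mul_assoc, swap_mul_self, one_mul]
        rw [e] at this
        simpa [mul_assoc] using this
    · refine ⟨α, h1, by simpa [hy] using h2, ?_⟩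
      have hs : Reach X c σ (σ * swap x y) :=
        Reach.swap hl.1 (by rw [hx]; exact fun h => hy h.symm)
      simpa [mul_assoc] using h3.trans hs.symm

theorem formPerm_pow_apply_mem {l : List V} {x : V} (hx : x ∈ l) (t : ℕ) :
    (l.formPerm ^ t) x ∈ l := by
  induction t with
  | zero => simpa
  | succ t ih =>
    rw [pow_succ', Perm.mul_apply]
    exact List.formPerm_apply_mem_of_mem ih

/-- If an even, positive number of tokens of colour `A` lies on an odd cycle, then an odd
permutation of the tokens of colour `A` can be realised. -/
theorem exists_odd_of_even_countP [Fintype V] {l : List V} (hd : l.Nodup) (hodd : Odd l.length)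
    (hl : ∀ n, (l.rotate n).IsChain X.Adj) (heven : Even (l.countP fun z => c (σ z) = A))
    (hpos : 0 < l.countP fun z => c (σ z) = A) :
    ∃ α : Perm V, (∀ y, c y ≠ A → α y = y) ∧ Perm.sign α = -1 ∧ Reach X c (α * σ) σ := by
  -- In each rotation by one step an `A` token overtakes the odd number of other `A` tokens on the
  -- cycle, which costs a sign. After `l.length` rotations the cycle is back, and an odd number of
  -- signs remains.
  have key : ∀ t : ℕ, ∃ α : Perm V, (∀ y, c y ≠ A → α y = y) ∧ Perm.sign α = (-1) ^ t ∧
      Reach X c (α * σ * l.formPerm ^ t) σ := by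
    intro t
    induction t with
    | zero => exact ⟨1, by simp, by simp, by simpa using Reach.refl σ⟩
    | succ t ih =>
      obtain ⟨α, h1, h2, h3⟩ := ih
      set υ := α * σ * l.formPerm ^ t with hυ
      have hcount : (l.countP fun z => c (υ z) = A) = l.countP fun z => c (σ z) = A := by
        have hmem : ∀ x ∈ l, (l.formPerm ^ t) x ∈ l := fun x hx => formPerm_pow_apply_mem hx t
        rw [← countP_comp_perm hd hmem fun z => c (σ z) = A]
        refine List.countP_congr fun z _ => ?_
        simp [hυ, color_apply_of_fixes h1]
      obtain ⟨x, hxl, hx⟩ := List.countP_pos_iff.1 (hcount ▸ hpos)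
      obtain ⟨a, b, hab⟩ := List.append_of_mem hxl
      have hrot : l.rotate a.length = x :: (b ++ a) := by
        rw [hab, List.rotate_append_length_eq]; rfl
      have hcount' : (List.countP (fun z => c (υ z) = A) (b ++ a)) + 1 =
          l.countP fun z => c (σ z) = A := by
        rw [← hcount, ← (List.rotate_perm l a.length).countP_eq, hrot, List.countP_cons, if_pos hx]
      obtain ⟨β, h4, h5, h6⟩ := exists_reach_mul_formPerm (c := c) (A := A) (σ := υ)
        (hrot ▸ hl a.length) (hrot ▸ List.nodup_rotate.2 hd) (by simpa using hx)
      rw [← hrot, List.formPerm_rotate _ hd] at h6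
      refine ⟨β * α, fun y hy => by rw [Perm.mul_apply, h1 y hy, h4 y hy], ?_, ?_⟩
      · have : Odd (List.countP (fun z => c (υ z) = A) (b ++ a)) := by
          rw [← hcount'] at heven
          exact Nat.not_even_iff_odd.1 fun h => by
            rw [Nat.even_add_one] at heven
            exact heven h
        rw [Perm.sign_mul, h2, h5, this.neg_one_pow, pow_succ, mul_comm]
      · have := h6.trans h3
        simpa [hυ, mul_assoc, pow_succ] using this
  obtain ⟨α, h1, h2, h3⟩ := key l.length
  have h4 : l.formPerm ^ l.length = 1 := List.formPerm_pow_length_eq_one_of_nodup l hd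
  rw [h4, mul_one] at h3
  exact ⟨α, h1, by rw [h2, hodd.neg_one_pow], h3⟩

/-- An odd number of tokens not coloured `A` is placed on the cycle and the rest off it, leaving an
even, positive number of `A` tokens on the cycle. -/
theorem exists_odd_of_odd_cycle [Fintype V] (hX : X.Preconnected) {l : List V} (hd : l.Nodup)
    (hodd : Odd l.length) (hl3 : 3 ≤ l.length) (hlV : l.length < Fintype.card V)
    (hl : ∀ n, (l.rotate n).IsChain X.Adj) (hA : 2 ≤ Nat.card {x // c x = A})
    (hB : 1 ≤ Nat.card {x // c x ≠ A}) (σ : Perm V) :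
    ∃ α : Perm V, (∀ y, c y ≠ A → α y = y) ∧ Perm.sign α = -1 ∧ α ∈ realized X c σ := by
  have hcard : Nat.card {x // c x = A} + Nat.card {x // c x ≠ A} = Fintype.card V := by
    simp only [Nat.card_eq_fintype_card, Fintype.card_subtype]
    exact Finset.card_filter_add_card_filter_not _
  set a := Nat.card {x // c x = A} with ha
  set b := Nat.card {x // c x ≠ A} with hb
  set L := l.length with hL
  -- At least `b + L - Fintype.card V` of these tokens must lie on the cycle. Rounding up to an odd
  -- number stays within `b` because the cycle is not spanning, and within `L - 2` because there are
  -- two `A` tokens and `L` is odd.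
  obtain ⟨j, hj1, hj2, hj3, hj4⟩ : ∃ j, Odd j ∧ j + 2 ≤ L ∧ j ≤ b ∧
      b - j ≤ Fintype.card V - L := by
    by_cases h1 : b + L ≤ Fintype.card V + 1
    · exact ⟨1, odd_one, by omega, hB, by omega⟩
    · rcases Nat.even_or_odd (b + L - Fintype.card V) with he | ho
      · refine ⟨b + L - Fintype.card V + 1, he.add_one, ?_, by omega, by omega⟩
        obtain ⟨r, hr⟩ := he
        obtain ⟨s, hs⟩ := hodd
        omega
      · exact ⟨_, ho, by omega, by omega, by omega⟩
  have hlc : l.toFinset.card = L := List.toFinset_card_of_nodup hd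
  obtain ⟨J, hJl, hJ⟩ := Finset.exists_subset_card_eq (s := l.toFinset) (n := j) (by omega)
  obtain ⟨J', hJl', hJ'⟩ := Finset.exists_subset_card_eq (s := l.toFinsetᶜ) (n := b - j)
    (by rw [Finset.card_compl, hlc]; exact hj4)
  have hdisj : Disjoint J J' := Finset.disjoint_of_subset_left hJl
    (Finset.disjoint_of_subset_right hJl' disjoint_compl_right)
  have huniv : (X.induce (Set.univ : Set V)).Preconnected := by
    intro x y
    have := (SimpleGraph.induceUnivIso X).symm.reachable_iff.2 (hX x y)
    exact this
  obtain ⟨τ, r, hτ, -⟩ := exists_reach_support (c := c) (S := Set.univ) huniv (A := A) (σ := σ)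
    (by simp) (N := J ∪ J') (by simp)
    (by rw [Finset.card_union_of_disjoint hdisj, hJ, hJ']; omega)
  have hcount : (l.countP fun z => c (τ z) = A) + j = L := by
    have h1 := List.length_eq_countP_add_countP (fun z => decide (c (τ z) = A)) (l := l)
    have h2 : (l.countP fun z => decide ¬ decide (c (τ z) = A) = true) = j := by
      rw [← hJ, List.countP_eq_length_filter, ← List.toFinset_card_of_nodup (hd.filter _)]
      congr 1
      ext z
      simp only [List.mem_toFinset, List.mem_filter, decide_eq_true_eq]
      rw [← ne_eq, hτ, Finset.mem_union]
      constructor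
      · rintro ⟨hz, h | h⟩
        · exact h
        · exact absurd (List.mem_toFinset.2 hz) (Finset.mem_compl.1 (hJl' h))
      · exact fun h => ⟨List.mem_toFinset.1 (hJl h), Or.inl h⟩
    omega
  obtain ⟨α, h1, h2, h3⟩ := exists_odd_of_even_countP (X := X) (c := c) (A := A) (σ := τ) hd hodd hl
    (by
      obtain ⟨r, hr⟩ := hj1
      obtain ⟨s, hs⟩ := hodd
      exact ⟨s - r, by omega⟩) (by omega)
  exact ⟨α, h1, h2, r.realized_eq ▸ ⟨color_apply_of_fixes h1, h3⟩⟩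

end OddCycle

/-! ### All placements are reachable. -/

section TwoColors

variable {V ι : Type*} [DecidableEq V] [Fintype V] {X : SimpleGraph V} {c : V → ι} {A B : ι}
  {σ : Perm V}

/-- The colour-preserving permutations of the tokens that fix all tokens of colour `A`. -/
def colorFixer (c : V → ι) (A : ι) : Subgroup (Perm V) where
  carrier := {β | (∀ x, c (β x) = c x) ∧ ∀ x, c x = A → β x = x}
  one_mem' := by simp
  mul_mem' := by
    rintro f g ⟨hf, hf'⟩ ⟨hg, hg'⟩
    exact ⟨fun x => by simp [hf, hg], fun x hx => by simp [hg' x hx, hf' x hx]⟩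
  inv_mem' := by
    rintro f ⟨hf, hf'⟩
    refine ⟨fun x => by simpa using (hf (f⁻¹ x)).symm, fun x hx => ?_⟩
    rw [Perm.inv_eq_iff_eq]
    exact (hf' x hx).symm

theorem fixesColor_colorFixer {V ι : Type*} (c : V → ι) (A : ι) : FixesColor c A (colorFixer c A) :=
  fun _ h => h

/-- If all tokens of colour `A` are swappable up to permutations of the other tokens, and some odd
permutation of the tokens of colour `A` can be realised, then all permutations of these tokens
can be realised. -/
theorem mem_realized_of_odd [DecidableEq ι]
    (hA : ∀ p q, c p = A → c q = A → Swappable X c (colorFixer c A) σ p q) {α : Perm V}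
    (hα : ∀ y, c y ≠ A → α y = y) (hs : Perm.sign α = -1) (hmem : α ∈ realized X c σ)
    {g : Perm V} (hg : ∀ y, c y ≠ A → g y = y) : g ∈ realized X c σ := by
  let f : Perm {x // c x = A} →* Perm V := Perm.ofSubtype
  have hfix : ∀ (n : Perm {x // c x = A}) (y : V), c y ≠ A → f n y = y :=
    fun n y hy => Perm.ofSubtype_apply_of_not_mem n hy
  let N := (realized X c σ).comap f
  -- Conjugation by `swap x y` agrees on these permutations with conjugation by the realised element
  -- `β * swap x y`, since `β` moves no `A` token.
  have hN : N.Normal := by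
    refine ⟨fun n hn k => ?_⟩
    induction k using Perm.swap_induction_on with
    | one => simpa using hn
    | swap_mul k x y hxy ih =>
      obtain ⟨β, hβ, hβ'⟩ := hA x y x.2 y.2
      set n' := k * n * k⁻¹ with hn'
      have e1 : swap x y * k * n * (swap x y * k)⁻¹ = swap x y * n' * (swap x y)⁻¹ := by
        simp [hn', mul_assoc]
      have e2 : f (swap x y * n' * (swap x y)⁻¹) =
          β * swap (x : V) y * f n' * (β * swap (x : V) y)⁻¹ := by
        have h1 : f (swap x y) = swap (x : V) y := Perm.ofSubtype_swap_eq x y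
        have h2 : Commute β (f (swap x y * n' * (swap x y)⁻¹)) := by
          refine Perm.Disjoint.commute fun z => ?_
          by_cases hz : c z = A
          · exact Or.inl (hβ.2 z hz)
          · exact Or.inr (hfix _ z hz)
        have h3 : β * f (swap x y * n' * (swap x y)⁻¹) * β⁻¹ =
            f (swap x y * n' * (swap x y)⁻¹) := by rw [h2.eq, mul_inv_cancel_right]
        rw [← h3, map_mul, map_mul, map_inv, h1]
        simp only [mul_assoc, mul_inv_rev]
      rw [e1, Subgroup.mem_comap, e2]
      exact mul_mem (mul_mem hβ' ih) (inv_mem hβ')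
  have hlift : ∀ k : Perm V, (∀ y, c y ≠ A → k y = y) →
      ∃ n : Perm {x // c x = A}, f n = k := by
    intro k hk
    exact ⟨k.subtypePerm (fun x => by rw [color_apply_of_fixes hk]),
      Perm.ofSubtype_subtypePerm _ fun x hx => by_contra fun h => hx (hk x h)⟩
  obtain ⟨n, hn⟩ := hlift α hα
  have hnN : n ∈ N := by rw [Subgroup.mem_comap, hn]; exact hmem
  have hns : Perm.sign n = -1 := by rw [← hs, ← hn]; exact (Perm.sign_ofSubtype n).symm
  obtain ⟨k, hk⟩ := hlift g hg
  have : k ∈ N := by rw [normal_eq_top_of_odd N hnN hns]; trivial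
  rwa [Subgroup.mem_comap, hk] at this

/-- Two colours: the placements of the tokens are all reachable from each other. -/
theorem reach_of_two_colors [DecidableEq ι] {m : ℕ} (hX : X.Connected) (hbip : ¬ X.IsBipartite)
    (hcyc : ¬ X.IsCycleGraph) (hm : 2 ≤ m) (hbr : ¬ X.ContainsKBridge m) (hAB : A ≠ B)
    (hc : ∀ x, c x = A ∨ c x = B) (hA : m ≤ Nat.card {x // c x = A})
    (hB : m ≤ Nat.card {x // c x = B}) (σ τ : Perm V) : Reach X c σ τ := by
  have hne : ∀ x, c x ≠ A ↔ c x = B := fun x =>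
    ⟨(hc x).resolve_left, fun h h' => hAB (h'.symm.trans h)⟩
  have hne' : ∀ x, c x ≠ B ↔ c x = A := fun x =>
    ⟨(hc x).resolve_right, fun h h' => hAB (h.symm.trans h')⟩
  have hcA : Nat.card {x // c x ≠ A} = Nat.card {x // c x = B} :=
    Nat.card_congr (Equiv.subtypeEquivRight hne)
  have hcB : Nat.card {x // c x ≠ B} = Nat.card {x // c x = A} :=
    Nat.card_congr (Equiv.subtypeEquivRight hne')
  obtain ⟨o, x, y, z, hx, hy, hz, hxy, hxz, hyz⟩ :=
    exists_claw hX hcyc fun h => hbip h.isBipartite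
  have hswap : ∀ C D, (∀ x, c x ≠ C ↔ c x = D) → ∀ b₁ b₂, c b₁ ≠ C → c b₂ ≠ C →
      swap b₁ b₂ ∈ colorFixer c C := by
    intro C D h b₁ b₂ h₁ h₂
    refine ⟨color_swap_apply (((h _).1 h₁).trans ((h _).1 h₂).symm), fun w hw => ?_⟩
    rw [swap_apply_of_ne_of_ne] <;> rintro rfl <;> contradiction
  have hsA : ∀ σ p q, c p = A → c q = A → Swappable X c (colorFixer c A) σ p q :=
    fun σ p q hp hq => swappable_of_claw hX.preconnected (fixesColor_colorFixer c A)
      (Or.inr (hswap A B hne)) hm (by omega) (Or.inl hbr) hx hy hz hxy hxz hyz σ hp hq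
  have hsB : ∀ σ p q, c p = B → c q = B → Swappable X c (colorFixer c B) σ p q :=
    fun σ p q hp hq => swappable_of_claw hX.preconnected (fixesColor_colorFixer c B)
      (Or.inr (hswap B A hne')) hm (by omega) (Or.inl hbr) hx hy hz hxy hxz hyz σ hp hq
  obtain ⟨l, hd, hodd, hl3, hlV, hl⟩ := exists_odd_cycle hbip hcyc
  have hall : ∀ σ (g : Perm V), (∀ y, c y ≠ A → g y = y) → g ∈ realized X c σ := by
    intro σ g hg
    obtain ⟨α, h1, h2, h3⟩ := exists_odd_of_odd_cycle (c := c) (A := A) hX.preconnected hd hodd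
      hl3 hlV hl (by omega) (by omega) σ
    exact mem_realized_of_odd (hsA σ) h1 h2 h3 hg
  refine reach_of_swap_mem_realized hX.preconnected (fun σ p q hpq => ?_) σ τ
  rcases hc p with hp | hp
  · refine hall σ _ fun w hw => ?_
    rw [swap_apply_of_ne_of_ne] <;> rintro rfl
    exacts [hw hp, hw (hpq.symm.trans hp)]
  -- The correction `β` moves only `A` tokens, so it is itself realised and can be cancelled.
  · obtain ⟨β, hβ, h⟩ := hsB σ p q hp (hpq.symm.trans hp)
    have hβ' := hall σ β fun w hw => hβ.2 w ((hne w).1 hw)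
    exact (Subgroup.mul_mem_cancel_left _ hβ').1 h

/-- At least three colours: the placements of the tokens are all reachable from each other. -/
theorem reach_of_three_colors {m : ℕ} (hX : X.Connected)
    (hcyc : ¬ X.IsCycleGraph) (htree : ¬ X.IsTree) (hm : 2 ≤ m)
    (hc : ∀ A, ∃ b₁ b₂, c b₁ ≠ A ∧ c b₂ ≠ A ∧ c b₁ ≠ c b₂)
    (hmA : ∀ A, m ≤ Nat.card {x // c x ≠ A})
    (hbr : ¬ X.ContainsKBridge m ∨ ∀ A, Fintype.card V ≤ Nat.card {x // c x ≠ A} + 2)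
    (σ τ : Perm V) : Reach X c σ τ := by
  obtain ⟨o, x, y, z, hx, hy, hz, hxy, hxz, hyz⟩ := exists_claw hX hcyc htree
  refine reach_of_swap_mem_realized hX.preconnected (fun σ p q hpq => ?_) σ τ
  -- Two colours other than `c p` are available, so no correction is needed and `K` can be trivial.
  obtain ⟨β, hβ, h⟩ := swappable_of_claw (K := ⊥) (A := c p) hX.preconnected
    (by rintro β rfl; simp) (Or.inl (hc (c p))) hm (hmA (c p)) (hbr.imp_right fun h => h (c p))
    hx hy hz hxy hxz hyz σ rfl hpq.symm
  obtain rfl := Subgroup.mem_bot.1 hβ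
  simpa using h

end TwoColors

/-! ### From coloured tokens back to complete multipartite graphs. -/

section Transport

variable {V : Type*} {X : SimpleGraph V} {t : ℕ} {k : Fin t → ℕ}

/-- The friends-and-strangers graph of a complete multipartite graph is connected if all placements
of tokens labelled by the positions, and coloured by the parts, are reachable from each other. -/
theorem connected_of_reach [DecidableEq V] (e : V ≃ Σ i, Fin (k i))
    (h : ∀ σ τ : Perm V, Reach X (fun v => (e v).1) σ τ) :
    (X.friendsStrangers (SimpleGraph.completeMultipartiteGraph fun i => Fin (k i))).Connected := by
  have key : ∀ σ τ : Perm V, Reach X (fun v => (e v).1) σ τ →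
      (X.friendsStrangers (SimpleGraph.completeMultipartiteGraph fun i => Fin (k i))).Reachable
        (σ.trans e) (τ.trans e) := by
    intro σ τ hr
    induction hr with
    | refl => exact SimpleGraph.Reachable.refl _
    | tail _ h ih =>
      obtain ⟨a, b, hab, hc, rfl⟩ := h
      refine ih.trans (SimpleGraph.Adj.reachable
        ⟨a, b, hab, hc, by simp, by simp, fun x hxa hxb => ?_⟩)
      simp [swap_apply_of_ne_of_ne hxa hxb]
  refine @SimpleGraph.Connected.mk _ _ (fun f g => ?_) ⟨e⟩
  simpa [Equiv.trans_assoc] using key (f.trans e.symm) (g.trans e.symm) (h _ _)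

theorem card_color_eq (e : V ≃ Σ i, Fin (k i)) (A : Fin t) :
    Nat.card {v // (e v).1 = A} = k A := by
  have h1 : Nat.card {v // (e v).1 = A} = Nat.card {w : Σ i, Fin (k i) // w.1 = A} :=
    Nat.card_congr (e.subtypeEquiv fun _ => Iff.rfl)
  rw [h1, Nat.card_congr (Equiv.sigmaSubtype A)]
  simp

theorem card_color_ne [Fintype V] (e : V ≃ Σ i, Fin (k i)) (A : Fin t) :
    k A + Nat.card {v // (e v).1 ≠ A} = Fintype.card V := by
  rw [← card_color_eq e A]
  simp only [Nat.card_eq_fintype_card, Fintype.card_subtype]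
  exact Finset.card_filter_add_card_filter_not _

end Transport

end FriendsStrangers

open FriendsStrangers

theorem theorem1p5 {V : Type*} [Fintype V] (X : SimpleGraph V)
    (t : ℕ) (ht : 2 ≤ t) (k : Fin t → ℕ) (hk : ∀ i, 1 ≤ k i) (hmono : Monotone k)
    (n : ℕ) (hn : n = ∑ i, k i) (hn4 : 4 ≤ n) (hV : Fintype.card V = n) :
    (t = 2 → 2 ≤ k ⟨0, by omega⟩ →
      X.Connected → ¬ X.IsBipartite → ¬ X.IsCycleGraph →
      ¬ X.ContainsKBridge (k ⟨0, by omega⟩) →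
      (X.friendsStrangers (SimpleGraph.completeMultipartiteGraph fun i => Fin (k i))).Connected) ∧
    (2 < t → (2 < k ⟨t - 1, by omega⟩ ∨ 1 < Finset.univ.gcd k) →
      X.Connected → ¬ X.IsCycleGraph → ¬ X.IsTree →
      ¬ X.ContainsKBridge (n - k ⟨t - 1, by omega⟩) →
      (X.friendsStrangers (SimpleGraph.completeMultipartiteGraph fun i => Fin (k i))).Connected) ∧
    (2 < t → k ⟨0, by omega⟩ = 1 → k ⟨t - 1, by omega⟩ = 2 →
      X.Connected → ¬ X.IsCycleGraph → ¬ X.IsTree →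
      (X.friendsStrangers (SimpleGraph.completeMultipartiteGraph fun i => Fin (k i))).Connected) := by
  classical
  have hcard : Fintype.card V = Fintype.card (Σ i, Fin (k i)) := by
    rw [hV, hn, Fintype.card_sigma]
    simp
  have e : V ≃ Σ i, Fin (k i) := Fintype.equivOfCardEq hcard
  have hsurj : ∀ A, ∃ v, (e v).1 = A := fun A => ⟨e.symm ⟨A, 0, hk A⟩, by simp⟩
  have hlast : ∀ A, k A ≤ k ⟨t - 1, by omega⟩ := fun A => hmono (Fin.le_def.2 (by
    have := A.2
    simp only
    omega))
  have hcol : 2 < t → ∀ A, ∃ b₁ b₂, (e b₁).1 ≠ A ∧ (e b₂).1 ≠ A ∧ (e b₁).1 ≠ (e b₂).1 := by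
    intro ht2 A
    obtain ⟨B, hB, C, hC, hBC⟩ := Finset.one_lt_card.1
      (show 1 < (Finset.univ.erase A).card by
        rw [Finset.card_erase_of_mem (Finset.mem_univ A), Finset.card_univ, Fintype.card_fin]
        omega)
    obtain ⟨v, rfl⟩ := hsurj B
    obtain ⟨w, rfl⟩ := hsurj C
    exact ⟨v, w, Finset.ne_of_mem_erase hB, Finset.ne_of_mem_erase hC, hBC⟩
  have htwo : 2 < t → ∀ A, 2 ≤ Nat.card {v // (e v).1 ≠ A} := by
    intro ht2 A
    obtain ⟨b₁, b₂, h₁, h₂, h₁₂⟩ := hcol ht2 A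
    exact Finite.one_lt_card_iff_nontrivial.2
      ⟨⟨b₁, h₁⟩, ⟨b₂, h₂⟩, fun h => h₁₂ (by rw [Subtype.mk.inj h])⟩
  refine ⟨?_, ?_, ?_⟩
  · rintro rfl hk0 hX hbip hcyc hbr
    refine connected_of_reach e (reach_of_two_colors (A := 0) (B := 1) hX hbip hcyc hk0 hbr
      (by simp) (fun v => ?_) ?_ ?_)
    · generalize (e v).1 = i
      fin_cases i <;> simp
    · rw [card_color_eq]; rfl
    · rw [card_color_eq]; exact hmono (Fin.zero_le _)
  · intro ht2 _ hX hcyc htree hbr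
    have h1 := fun A => card_color_ne e A
    refine connected_of_reach e (reach_of_three_colors hX hcyc htree ?_ (hcol ht2) (fun A => ?_)
      (Or.inl hbr))
    · have := h1 ⟨t - 1, by omega⟩
      have := htwo ht2 ⟨t - 1, by omega⟩
      omega
    -- The last part is the largest, so its complement has the fewest tokens and the bound holds for
    -- every colour.
    · have := h1 A
      have := hlast A
      omega
  · intro ht2 _ hk2 hX hcyc htree
    -- Every part has at most two elements, so the initial good set is already everything and
    -- bridges play no role.
    refine connected_of_reach e (reach_of_three_colors hX hcyc htree le_rfl (hcol ht2) (htwo ht2)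
      (Or.inr fun A => ?_))
    have := card_color_ne e A
    have := hlast A
    omega
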